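/- Let $d\ge 1$ be an integer. For $\lambda\in\mathbb R\cup i(-\tfrac d2,\tfrac d2)$ and $\sigma\in\mathbb C\setminus[1,\infty)$ let $$G^{(d)}_\lambda(\sigma)=\frac{\Gamma(\frac d2+i\lambda)\Gamma(\frac d2-i\lambda)}{(4\pi)^{\frac{d+1}2}\,\Gamma(\frac{d+1}2)}\;{}_2F_1\Big(\tfrac d2+i\lambda,\tfrac d2-i\lambda;\tfrac{d+1}2;\tfrac{1+\sigma}2\Big)$$ be the free propagator, where ${}_2F_1$ is analytically continued to $\mathbb C\setminus[1,\infty)$. The radial variable $\rho$ is defined by $\rho=\frac{1-\sqrt{1-z}}{1+\sqrt{1-z}}$ with $z=\frac{1+\sigma}2$; equivalently $\frac{1+\sigma}2=\frac{4\rho}{(1+\rho)^2}$, $|\rho|<1$. Let $$B_n(d,\lambda)=\frac{\Gamma(\frac d2+i\lambda)\Gamma(\frac d2-i\lambda)}{(4\pi)^{\frac{d+1}2}\Gamma(\frac{d+1}2)}\,b_n(d,\lambda),$$ $$b_n(d,\lambda)=\sum_{l=0}^{\min(d,n)}\sum_{k=0}^{n-l}\binom dl\frac{(\frac{d-1}2)_k\,(n-l-k)!}{k!\,(\frac{d+1}2)_{n-l-k}}\prod_{\pm}a_{n-l-k}\Big(\tfrac{d+1}4,-\tfrac{d-1}4\pm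 i\lambda\Big),$$ $$a_n(h,\delta)=\sum_{k=0}^n\frac{(-1)^k(h-\delta)_k(h+\delta)_{n-k}}{k!\,(n-k)!}.$$ Let $G_{\mathcal O}$ be a function of pairs of points of the unit sphere $S^{d+1}\subset\mathbb R^{d+2}$ (a scalar two-point function). Assume that there are nonnegative spectral densities $\varrho^{\mathcal P}$ on $\mathbb R$ and $\varrho^{\mathcal C}$ on $(-\frac d2,\frac d2)$ (understood as positive measures $\varrho(\lambda)\,d\lambda$, so that delta functions are allowed) such that for all $Y_1\ne Y_2$ in $S^{d+1}$, with $\sigma=Y_1\cdot Y_2$, $$G_{\mathcal O}(Y_1,Y_2)=\int_{\mathbb R}d\lambda\,\varrho^{\mathcal P}(\lambda)\,G^{(d)}_\lambda(\sigma)+\int_{-d/2}^{d/2}d\lambda\,\varrho^{\mathcal C}(\lambda)\,G^{(d)}_{i\lambda}(\sigma),$$ where both integrals converge. Then for every $n\ge 0$ the integrals in $$c_n=\int_{\mathbb R}d\lambda\,\varrho^{\mathcal P}(\lambda)\,B_n(d,\lambda)+\int_{-d/2}^{d/2}d\lambda\,\varrho^{\mathcal C}(\lambda)\,B_n(d,i\lambda)$$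 converge and $c_n$ is real and nonnegative; for all $Y_1\neq Y_2$ in $S^{d+1}$ the radial variable $\rho$ of $\sigma=Y_1\cdot Y_2$ satisfies $|\rho|<1$ and $$G_{\mathcal O}(Y_1,Y_2)=\sum_{n=0}^\infty c_n\rho^n;$$ and for every complex $\rho$ with $|\rho|<1$ the series $\sum_n c_n\rho^n$ converges absolutely, both integrals of the above representation converge absolutely at $\sigma=\frac{8\rho}{(1+\rho)^2}-1$, and their sum, which extends $G_{\mathcal O}$ to the open unit disc of $\rho$, equals $\sum_{n=0}^\infty c_n\rho^n$. -/

import Mathlib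

open MeasureTheory

noncomputable section

namespace DeSitter

/-- The cut plane `ℂ \ [1, ∞)`. -/
def cutPlane : Set ℂ := {z | 1 - z ∈ Complex.slitPlane}

/-- `F` is an analytic continuation to the cut plane of the regularized hypergeometric series
`∑ (a)ₙ (b)ₙ zⁿ / (Γ(c + n) n!)`. -/
def IsHypergeometricContinuation (a b c : ℂ) (F : ℂ → ℂ) : Prop :=
  AnalyticOnNhd ℂ F cutPlane ∧
    ∀ z : ℂ, ‖z‖ < 1 → F z = Complex.regularizedGaussHGFun a b c z

open Classical in
/-- The regularized hypergeometric function `𝐅(a, b; c; z) = ₂F₁(a, b; c; z) / Γ(c)` on the cut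
plane: the (unique) analytic continuation of the hypergeometric series. -/
def hypergeometricF (a b c : ℂ) : ℂ → ℂ :=
  if h : ∃ F : ℂ → ℂ, IsHypergeometricContinuation a b c F then h.choose
  else Complex.regularizedGaussHGFun a b c

/-- The continuation is unique on the cut plane, so the choice in the definition is harmless. -/
theorem hypergeometricF_eqOn {a b c : ℂ} {F : ℂ → ℂ}
    (hF : IsHypergeometricContinuation a b c F) :
    Set.EqOn (hypergeometricF a b c) F cutPlane := by
  have h : ∃ F : ℂ → ℂ, IsHypergeometricContinuation a b c F := ⟨F, hF⟩
  have hc := h.choose_spec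
  have hdef : hypergeometricF a b c = h.choose := by
    unfold hypergeometricF
    rw [dif_pos h]
  rw [hdef]
  have hconn : IsPreconnected cutPlane := by
    have h1 : cutPlane = (fun z : ℂ => 1 - z) '' Complex.slitPlane := by
      ext z
      constructor
      · intro hz
        exact ⟨1 - z, hz, by simp⟩
      · rintro ⟨w, hw, rfl⟩
        simpa [cutPlane] using hw
    rw [h1]
    exact (Complex.starConvex_one_slitPlane.isPathConnected (by simp)).isConnected.isPreconnected.image _
      (by fun_prop)
  refine hc.1.eqOn_of_preconnected_of_eventuallyEq hF.1 hconn (z₀ := 0) (by simp [cutPlane]) ?_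
  filter_upwards [Metric.ball_mem_nhds (0 : ℂ) one_pos] with z hz
  have hz' : ‖z‖ < 1 := by simpa using hz
  rw [hc.2 z hz', hF.2 z hz']

/-- The free propagator `G_λ^{(d)}(σ)` of a scalar of mass `m² = d²/4 + λ²` in the Bunch-Davies
vacuum, with unit de Sitter radius. -/
def freePropagator (d : ℕ) (lam σ : ℂ) : ℂ :=
  Complex.Gamma ((d : ℂ) / 2 + Complex.I * lam) * Complex.Gamma ((d : ℂ) / 2 - Complex.I * lam) /
      (((4 * Real.pi) ^ (((d : ℝ) + 1) / 2) : ℝ) : ℂ) *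
    hypergeometricF ((d : ℂ) / 2 + Complex.I * lam) ((d : ℂ) / 2 - Complex.I * lam)
      (((d : ℂ) + 1) / 2) ((1 + σ) / 2)

/-- The Pochhammer symbol `(x)ₙ`. -/
def poch (x : ℂ) (n : ℕ) : ℂ := (ascPochhammer ℂ n).eval x

/-- `aₙ(h, δ) = ∑_{k=0}^n (-1)^k (h-δ)_k (h+δ)_{n-k} / (k! (n-k)!)`. -/
def aCoeff (n : ℕ) (h δ : ℂ) : ℂ :=
  ∑ k ∈ Finset.range (n + 1),
    (-1) ^ k * poch (h - δ) k * poch (h + δ) (n - k) / ((k.factorial : ℂ) * ((n - k).factorial : ℂ))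

/-- The coefficients `bₙ(d, λ)`; the inner sum runs over `0 ≤ k ≤ n - l` and is empty if `l > n`. -/
def bCoeff (d n : ℕ) (lam : ℂ) : ℂ :=
  ∑ l ∈ Finset.range (d + 1), ∑ k ∈ Finset.range (n + 1 - l),
    (d.choose l : ℂ) *
      (poch (((d : ℂ) - 1) / 2) k * ((n - l - k).factorial : ℂ) /
        ((k.factorial : ℂ) * poch (((d : ℂ) + 1) / 2) (n - l - k))) *
      (aCoeff (n - l - k) (((d : ℂ) + 1) / 4) (-(((d : ℂ) - 1) / 4) + Complex.I * lam) *
        aCoeff (n - l - k) (((d : ℂ) + 1) / 4) (-(((d : ℂ) - 1) / 4) - Complex.I * lam))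

/-- The coefficients `Bₙ(d, λ) = Γ(d/2 ± iλ) / ((4π)^{(d+1)/2} Γ((d+1)/2)) · bₙ(d, λ)`. -/
def BCoeff (d n : ℕ) (lam : ℂ) : ℂ :=
  Complex.Gamma ((d : ℂ) / 2 + Complex.I * lam) * Complex.Gamma ((d : ℂ) / 2 - Complex.I * lam) /
      ((((4 * Real.pi) ^ (((d : ℝ) + 1) / 2) : ℝ) : ℂ) * Complex.Gamma (((d : ℂ) + 1) / 2)) *
    bCoeff d n lam

/-- The interval `(-d/2, d/2)` that parametrizes the complementary series. -/
def complementaryRange (d : ℕ) : Set ℝ := Set.Ioo (-((d : ℝ) / 2)) ((d : ℝ) / 2)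

/-- (Absolute) convergence of the spectral integral of `f`: here `f` is evaluated at `λ ∈ ℝ`
against the principal spectral measure `μP` and at `iλ`, `λ ∈ (-d/2, d/2)`, against the
complementary one `μC`. -/
def SpectralConverges (d : ℕ) (μP μC : Measure ℝ) (f : ℂ → ℂ) : Prop :=
  Integrable (fun lam : ℝ => f (lam : ℂ)) μP ∧
    IntegrableOn (fun lam : ℝ => f (Complex.I * (lam : ℂ))) (complementaryRange d) μC

/-- The spectral integral `∫_ℝ dμP(λ) f(λ) + ∫_{(-d/2, d/2)} dμC(λ) f(iλ)`.  Spectral densities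
are positive measures `dμ = ϱ(λ) dλ`: a nonnegative function `ϱ` is the measure
`volume.withDensity (fun l => ENNReal.ofReal (ϱ l))`, and delta functions are allowed. -/
def spectralIntegral (d : ℕ) (μP μC : Measure ℝ) (f : ℂ → ℂ) : ℂ :=
  (∫ lam : ℝ, f (lam : ℂ) ∂μP) +
    (∫ lam in complementaryRange d, f (Complex.I * (lam : ℂ)) ∂μC)

/-- The unit sphere `S^{d+1}` in `ℝ^{d+2}`. -/
abbrev Sphere (d : ℕ) : Type := Metric.sphere (0 : EuclideanSpace ℝ (Fin (d + 2))) 1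

/-- The two-point invariant `σ = Y₁ · Y₂` on the sphere. -/
def sphereSigma {d : ℕ} (Y₁ Y₂ : Sphere d) : ℝ :=
  inner ℝ (Y₁ : EuclideanSpace ℝ (Fin (d + 2))) (Y₂ : EuclideanSpace ℝ (Fin (d + 2)))

/-- The two-point function `G` on `S^{d+1}` has, at all pairs of non-coincident points, a
convergent Källén–Lehmann representation over the principal and complementary series with the
positive spectral measures `μP` and `μC`. -/
def HasKallenLehmann (d : ℕ) (μP μC : Measure ℝ) (G : Sphere d → Sphere d → ℂ) : Prop :=
  ∀ Y₁ Y₂ : Sphere d, Y₁ ≠ Y₂ →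
    SpectralConverges d μP μC (fun lam => freePropagator d lam (sphereSigma Y₁ Y₂ : ℂ)) ∧
    G Y₁ Y₂ = spectralIntegral d μP μC (fun lam => freePropagator d lam (sphereSigma Y₁ Y₂ : ℂ))

/-- The radial variable `ρ = (1 - √(1-z)) / (1 + √(1-z))` with `z = (1+σ)/2` (principal root). -/
def radial (σ : ℂ) : ℂ :=
  (1 - (1 - (1 + σ) / 2) ^ (1 / 2 : ℂ)) / (1 + (1 - (1 + σ) / 2) ^ (1 / 2 : ℂ))

/-- The inverse change of variables: `(1+σ)/2 = 4ρ/(1+ρ)²`. -/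
def sigmaOfRadial (ρ : ℂ) : ℂ := 8 * ρ / (1 + ρ) ^ 2 - 1

end DeSitter

end

namespace DeSitter

open PowerSeries

/-! ### Binomial series and the coefficients `aₙ` -/

/-! Everything rests on one fact: for each `λ` in the spectrum, the propagator expanded in `ρ`
converges in the whole unit disc with coefficients `Bₙ(d, λ) ≥ 0`. At real `r ∈ [0, 1)` the spectral
integral of the propagator is then one of nonnegative series. It converges because `σ = 8r/(1+r)² -
1` fills `[-1, 1)`, the values attained at distinct points of the sphere. These integrals dominate
everything at complex `ρ` with `|ρ| = r`, so sum and integral may be interchanged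
(`integrate_series`).

The expansion itself is a bilinear generating function. With `a, b = d/2 ± iλ` and `c = (d+1)/2`,
the numbers `bₙ` are the coefficients of `(1+X)^d (1-X)^(-(d-1)/2) ∑ m!/(c)ₘ Aₘ Bₘ Xᵐ`, where `A`
and `B` are the coefficients of `(1-X)^(a-c) (1+X)^(-a)` and its analogue for `b`. This series and
`₂F₁(a, b; c; 4X/(1+X)²)` solve the same second-order equation with constant term 1, and a formal
solution is determined by its constant term (`bSeries_eq_fSeries`). Convergence in the disc comes
from the factorized form; the identity theorem then carries the equality to the cut plane, which `z
↦ ρ` maps onto the disc.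

Positivity on the principal series is immediate: `b` is the conjugate of `a`, so `Aₘ Bₘ = |Aₘ|²`. On
the complementary series, `a, b = d/2 ± ν`, these products can be negative. For `ν ≤ (d+1)/4` one
passes to the derivative in `ρ`, a multiple of the same kind of series in dimension `d + 2`, where
`Aₘ` and `Bₘ` both have sign `(-1)ᵐ`. A contiguous relation with nonnegative weights carries
positivity to larger `ν` when `d ≥ 3`, from `(d-2, ν-1)` and `(d, |ν-2|)`. The one gap, `d = 2` and
`3/4 < ν < 1`, is settled by the elementary closed form of the function. -/

theorem poch_zero (x : ℂ) : poch x 0 = 1 := by simp [poch]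

theorem poch_succ (x : ℂ) (n : ℕ) : poch x (n + 1) = poch x n * (x + n) := by
  simp [poch, ascPochhammer_succ_eval]

/-- The binomial series `(1 - X)^(-α)`. -/
noncomputable def binomSeries (α : ℂ) : ℂ⟦X⟧ :=
  PowerSeries.mk fun n => poch α n / (n.factorial : ℂ)

/-- The binomial series `(1 + X)^(-α)`. -/
noncomputable def altBinomSeries (α : ℂ) : ℂ⟦X⟧ :=
  PowerSeries.mk fun n => (-1) ^ n * poch α n / (n.factorial : ℂ)

theorem constantCoeff_derivative (f : ℂ⟦X⟧) : constantCoeff (d⁄dX ℂ f) = coeff 1 f := by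
  rw [← coeff_zero_eq_constantCoeff_apply, coeff_derivative]
  simp

theorem succ_mul_binom_coeff (α : ℂ) (n : ℕ) :
    ((n : ℂ) + 1) * (poch α (n + 1) / ((n + 1).factorial : ℂ)) =
      (α + n) * (poch α n / (n.factorial : ℂ)) := by
  have h1 : ((n : ℂ) + 1) ≠ 0 := by exact_mod_cast n.succ_ne_zero
  have h2 : ((n.factorial : ℕ) : ℂ) ≠ 0 := by exact_mod_cast n.factorial_ne_zero
  rw [poch_succ, Nat.factorial_succ]
  push_cast
  field_simp

theorem derivative_binomSeries (α : ℂ) :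
    (1 - X) * d⁄dX ℂ (binomSeries α) = C α * binomSeries α := by
  ext n
  have key := succ_mul_binom_coeff α
  rcases n with _ | n
  · have := key 0
    simp [sub_mul, constantCoeff_derivative, binomSeries] at this ⊢
    linear_combination this
  · have h1 := key n
    have h2 := key (n + 1)
    push_cast at h2
    simp only [sub_mul, one_mul, map_sub, coeff_succ_X_mul, coeff_derivative, coeff_C_mul,
      binomSeries, coeff_mk]
    push_cast
    linear_combination h2

theorem derivative_altBinomSeries (α : ℂ) :
    (1 + X) * d⁄dX ℂ (altBinomSeries α) = -C α * altBinomSeries α := by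
  ext n
  have key := succ_mul_binom_coeff α
  rcases n with _ | n
  · have := key 0
    simp [add_mul, constantCoeff_derivative, altBinomSeries] at this ⊢
    linear_combination this
  · have h2 := key (n + 1)
    push_cast at h2
    simp only [add_mul, one_mul, map_add, coeff_succ_X_mul, coeff_derivative, coeff_C_mul,
      altBinomSeries, coeff_mk, neg_mul, map_neg]
    push_cast
    linear_combination (-1) ^ (n + 2) * h2

/-- The series `(1 - X)^(-p) (1 + X)^(-q)`. -/
noncomputable def aSeries (p q : ℂ) : ℂ⟦X⟧ := altBinomSeries q * binomSeries p

theorem aCoeff_eq (n : ℕ) (h δ : ℂ) : aCoeff n h δ = coeff n (aSeries (h + δ) (h - δ)) := by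
  rw [aCoeff, aSeries, coeff_mul, Finset.Nat.sum_antidiagonal_eq_sum_range_succ_mk]
  refine Finset.sum_congr rfl fun k _ => ?_
  simp only [altBinomSeries, binomSeries, coeff_mk]
  ring

theorem derivative_aSeries (p q : ℂ) :
    (1 - X ^ 2) * d⁄dX ℂ (aSeries p q) = (C (p - q) + C (p + q) * X) * aSeries p q := by
  have h1 := derivative_binomSeries p
  have h2 := derivative_altBinomSeries q
  simp only [aSeries, Derivation.leibniz, smul_eq_mul, map_sub, map_add]
  linear_combination (1 - X) * binomSeries p * h2 + (1 + X) * altBinomSeries q * h1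

theorem coeff_aSeries_zero (p q : ℂ) : coeff 0 (aSeries p q) = 1 := by
  simp [aSeries, altBinomSeries, binomSeries, poch_zero]

theorem coeff_aSeries_one (p q : ℂ) : coeff 1 (aSeries p q) = p - q := by
  have h := congrArg (coeff 0) (derivative_aSeries p q)
  have h0 := coeff_aSeries_zero p q
  simp [constantCoeff_derivative, sub_mul, add_mul, mul_assoc] at h h0
  rw [h, h0, mul_one, mul_one]

theorem coeff_aSeries_succ_succ (p q : ℂ) (n : ℕ) :
    ((n : ℂ) + 2) * coeff (n + 2) (aSeries p q) =
      (p - q) * coeff (n + 1) (aSeries p q) + (n + p + q) * coeff n (aSeries p q) := by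
  have h := congrArg (coeff (n + 1)) (derivative_aSeries p q)
  have h2 : coeff (n + 1) (X ^ 2 * d⁄dX ℂ (aSeries p q)) = n * coeff n (aSeries p q) := by
    rcases n with _ | n
    · simp [coeff_X_pow_mul']
    · rw [show n + 1 + 1 = n + 2 from rfl, coeff_X_pow_mul, coeff_derivative]
      push_cast
      ring
  simp only [sub_mul, add_mul, one_mul, map_sub (coeff _), map_add (coeff _), mul_assoc,
    coeff_C_mul, coeff_succ_X_mul, h2, coeff_derivative] at h
  push_cast at h
  linear_combination h

/-! ### The series `∑ wₘ Aₘ Bₘ Xᵐ` -/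

/-- `∑ₘ m! / (c)ₘ Aₘ Bₘ Xᵐ`, where `A` and `B` are the coefficients of
`(1 - X)^(a - c) (1 + X)^(-a)` and `(1 - X)^(b - c) (1 + X)^(-b)`. -/
noncomputable def bilinSeries (a b c : ℂ) : ℂ⟦X⟧ :=
  PowerSeries.mk fun m => (m.factorial : ℂ) / poch c m *
    (coeff m (aSeries (c - a) a) * coeff m (aSeries (c - b) b))

theorem poch_ne_zero {c : ℂ} (hc : ∀ n : ℕ, c + n ≠ 0) (n : ℕ) : poch c n ≠ 0 := by
  induction n with
  | zero => simp [poch_zero]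
  | succ n ih => rw [poch_succ]; exact mul_ne_zero ih (hc n)

theorem weight_succ {c : ℂ} (hc : ∀ n : ℕ, c + n ≠ 0) (n : ℕ) :
    (c + n) * (((n + 1).factorial : ℂ) / poch c (n + 1)) =
      (n + 1) * ((n.factorial : ℂ) / poch c n) := by
  have h1 := poch_ne_zero hc n
  have h2 := hc n
  rw [poch_succ, Nat.factorial_succ]
  push_cast
  field_simp

/-- The three-term recurrences remove the outer indices 4 and 0 at the cost of cross terms such as
`a3 * b2`. Those enter only in the combination `α a3 b2 + β a2 b3`, which can be lowered once more;
the mixed terms then cancel because `α + β = 2 - 2c`. A generic product of two such sequences would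
not obey so short a recurrence. -/
theorem bilin_recurrence_aux {c α β k w0 w1 w2 w3 w4 a0 a1 a2 a3 a4 b0 b1 b2 b3 b4 : ℂ}
    (hαβ : α + β = 2 - 2 * c)
    (w01 : (c + k) * w1 = (k + 1) * w0) (w12 : (c + (k + 1)) * w2 = (k + 2) * w1)
    (w23 : (c + (k + 2)) * w3 = (k + 3) * w2) (w34 : (c + (k + 3)) * w4 = (k + 4) * w3)
    (ha2 : (k + 2) * a2 = α * a1 + (k + c) * a0) (ha3 : (k + 3) * a3 = α * a2 + (k + 1 + c) * a1)
    (ha4 : (k + 4) * a4 = α * a3 + (k + 2 + c) * a2)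
    (hb2 : (k + 2) * b2 = β * b1 + (k + c) * b0) (hb3 : (k + 3) * b3 = β * b2 + (k + 1 + c) * b1)
    (hb4 : (k + 4) * b4 = β * b3 + (k + 2 + c) * b2) :
    2 * (k + 4) * (k + 3 + c) * (w4 * (a4 * b4)) - 2 * (α * β) * (w3 * (a3 * b3)) +
      (-4 * (k + 2) * (k + 1) - (4 * c + 4) * (k + 2) + 4 * (α * β) - 8 * c ^ 2 + 14 * c - 8) *
        (w2 * (a2 * b2)) - 2 * (α * β) * (w1 * (a1 * b1)) +
      2 * (k + 1) * (k + c) * (w0 * (a0 * b0)) = 0 := by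
  have e4 : (k + 4) * (k + 3 + c) * (w4 * (a4 * b4)) =
      w3 * ((α * a3 + (k + 2 + c) * a2) * (β * b3 + (k + 2 + c) * b2)) := by
    rw [← ha4, ← hb4]
    linear_combination (k + 4) * a4 * b4 * w34
  have e0 : (k + 1) * (k + c) * (w0 * (a0 * b0)) =
      w1 * (((k + 2) * a2 - α * a1) * ((k + 2) * b2 - β * b1)) := by
    have h1 : (k + 2) * a2 - α * a1 = (k + c) * a0 := by linear_combination ha2
    have h2 : (k + 2) * b2 - β * b1 = (k + c) * b0 := by linear_combination hb2
    rw [h1, h2]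
    linear_combination -(k + c) * a0 * b0 * w01
  have e3 : w3 * (k + 2 + c) * (α * a3 * b2 + β * a2 * b3) =
      w2 * (α * (α * a2 + (k + 1 + c) * a1) * b2 + β * a2 * (β * b2 + (k + 1 + c) * b1)) := by
    rw [← ha3, ← hb3]
    linear_combination (α * a3 * b2 + β * a2 * b3) * w23
  have hβ : β = 2 - 2 * c - α := by linear_combination hαβ
  linear_combination (exp := 1) 2 * e4 + 2 * e0 + 2 * e3 + 2 * (k + 2 + c) * a2 * b2 * w23
    - 2 * ((k + 2) * a2 * b2 - β * a2 * b1 - α * a1 * b2) * w12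
    + 2 * w2 * a2 * b2 * (α + β + (2 - 2 * c)) * hαβ

theorem coeff_bilinSeries (a b c : ℂ) (m : ℕ) : coeff m (bilinSeries a b c) =
    (m.factorial : ℂ) / poch c m *
      (coeff m (aSeries (c - a) a) * coeff m (aSeries (c - b) b)) := by
  simp [bilinSeries]

theorem bilinSeries_recurrence {a b c : ℂ} (hc : ∀ n : ℕ, c + n ≠ 0) (hab : a + b + 1 = 2 * c)
    (k : ℕ) :
    2 * ((k : ℂ) + 4) * (k + 3 + c) * coeff (k + 4) (bilinSeries a b c) -
      2 * ((c - 2 * a) * (c - 2 * b)) * coeff (k + 3) (bilinSeries a b c) +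
      (-4 * ((k : ℂ) + 2) * (k + 1) - (4 * c + 4) * (k + 2) + 4 * ((c - 2 * a) * (c - 2 * b)) -
        8 * c ^ 2 + 14 * c - 8) * coeff (k + 2) (bilinSeries a b c) -
      2 * ((c - 2 * a) * (c - 2 * b)) * coeff (k + 1) (bilinSeries a b c) +
      2 * ((k : ℂ) + 1) * (k + c) * coeff k (bilinSeries a b c) = 0 := by
  have w0 := weight_succ hc k
  have w1 := weight_succ hc (k + 1)
  have w2 := weight_succ hc (k + 2)
  have w3 := weight_succ hc (k + 3)
  have ha := fun n => coeff_aSeries_succ_succ (c - a) a n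
  have hb := fun n => coeff_aSeries_succ_succ (c - b) b n
  have ha2 := ha k
  have ha3 := ha (k + 1)
  have ha4 := ha (k + 2)
  have hb2 := hb k
  have hb3 := hb (k + 1)
  have hb4 := hb (k + 2)
  push_cast at w1 w2 w3 ha3 ha4 hb3 hb4
  simp only [coeff_bilinSeries]
  refine bilin_recurrence_aux (α := c - 2 * a) (β := c - 2 * b) ?_ w0 ?_ ?_ ?_ ?_ ?_ ?_ ?_ ?_ ?_
  · linear_combination -2 * hab
  · linear_combination w1
  · linear_combination w2
  · linear_combination w3
  · linear_combination ha2
  · linear_combination ha3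
  · linear_combination ha4
  · linear_combination hb2
  · linear_combination hb3
  · linear_combination hb4

/-- The coefficient of `Xⁿ` is the five-term recurrence at `k = n - 3`. For `n = 0, 1, 2` some
indices would be negative, so these three relations are checked by hand as `g1`, `g2`, `g3`. -/
theorem bilinSeries_ode {a b c : ℂ} (hc : ∀ n : ℕ, c + n ≠ 0) (hab : a + b + 1 = 2 * c) :
    2 * X * (1 - X ^ 2) ^ 2 * d⁄dX ℂ (d⁄dX ℂ (bilinSeries a b c)) +
      (1 - X ^ 2) * (2 * C c - (2 * C c + 4) * X ^ 2) * d⁄dX ℂ (bilinSeries a b c) +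
      (C (-2 * ((c - 2 * a) * (c - 2 * b))) * (1 + X ^ 2) +
        C (4 * ((c - 2 * a) * (c - 2 * b)) - 8 * c ^ 2 + 14 * c - 8) * X +
        C (2 * c) * X ^ 3) * bilinSeries a b c = 0 := by
  have hrec := bilinSeries_recurrence hc hab
  have g0 : coeff 0 (bilinSeries a b c) = 1 := by
    rw [coeff_bilinSeries, coeff_aSeries_zero, coeff_aSeries_zero]; simp [poch_zero]
  have hw0 := weight_succ hc 0
  have hw1 := weight_succ hc 1
  have hw2 := weight_succ hc 2
  have w0 : ((0 : ℕ).factorial : ℂ) / poch c 0 = 1 := by simp [poch_zero]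
  have ha2 := coeff_aSeries_succ_succ (c - a) a 0
  have hb2 := coeff_aSeries_succ_succ (c - b) b 0
  have ha3 := coeff_aSeries_succ_succ (c - a) a 1
  have hb3 := coeff_aSeries_succ_succ (c - b) b 1
  rw [coeff_aSeries_one, coeff_aSeries_zero] at ha2 hb2
  rw [coeff_aSeries_one] at ha3 hb3
  have g1 : c * coeff 1 (bilinSeries a b c) = (c - 2 * a) * (c - 2 * b) := by
    rw [coeff_bilinSeries, coeff_aSeries_one, coeff_aSeries_one]
    rw [w0] at hw0
    push_cast at hw0
    linear_combination (c - a - a) * (c - b - b) * hw0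
  have hb' : b = 2 * c - 1 - a := by linear_combination hab
  have g2 : 4 * (1 + c) * coeff 2 (bilinSeries a b c) -
      2 * ((c - 2 * a) * (c - 2 * b)) * coeff 1 (bilinSeries a b c) +
      (4 * ((c - 2 * a) * (c - 2 * b)) - 8 * c ^ 2 + 14 * c - 8) *
        coeff 0 (bilinSeries a b c) = 0 := by
    rw [g0, coeff_bilinSeries, coeff_bilinSeries, coeff_aSeries_one, coeff_aSeries_one]
    rw [w0] at hw0
    push_cast at hw0 hw1 ha2 hb2
    subst hb'
    linear_combination 4 * coeff 2 (aSeries (c - a) a) *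
        coeff 2 (aSeries (c - (2 * c - 1 - a)) (2 * c - 1 - a)) * hw1 +
      4 * ((1 : ℕ).factorial / poch c 1) *
        coeff 2 (aSeries (c - (2 * c - 1 - a)) (2 * c - 1 - a)) * ha2 +
      2 * ((1 : ℕ).factorial / poch c 1) * ((c - 2 * a) ^ 2 + c) * hb2 +
      2 * ((c - 2 * a) ^ 2 + (c - 2 * (2 * c - 1 - a)) ^ 2 + c) * hw0
  have g3 : 6 * (2 + c) * coeff 3 (bilinSeries a b c) -
      2 * ((c - 2 * a) * (c - 2 * b)) * coeff 2 (bilinSeries a b c) +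
      (-(4 * c + 4) + 4 * ((c - 2 * a) * (c - 2 * b)) - 8 * c ^ 2 + 14 * c - 8) *
        coeff 1 (bilinSeries a b c) -
      2 * ((c - 2 * a) * (c - 2 * b)) * coeff 0 (bilinSeries a b c) = 0 := by
    rw [g0, coeff_bilinSeries, coeff_bilinSeries, coeff_bilinSeries, coeff_aSeries_one,
      coeff_aSeries_one]
    rw [w0] at hw0
    push_cast at hw0 hw1 hw2 ha2 hb2 ha3 hb3
    subst hb'
    linear_combination 6 * coeff 3 (aSeries (c - a) a) *
        coeff 3 (aSeries (c - (2 * c - 1 - a)) (2 * c - 1 - a)) * hw2 +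
      6 * ((2 : ℕ).factorial / poch c 2) *
        coeff 3 (aSeries (c - (2 * c - 1 - a)) (2 * c - 1 - a)) * ha3 +
      2 * ((2 : ℕ).factorial / poch c 2) *
        ((c - 2 * a) * coeff 2 (aSeries (c - a) a) + (1 + c) * (c - 2 * a)) * hb3 +
      2 * ((c - 2 * a) * (c - 2 * (2 * c - 1 - a))) * (coeff 2 (aSeries (c - a) a) +
        coeff 2 (aSeries (c - (2 * c - 1 - a)) (2 * c - 1 - a)) + 1 + c) * hw1 +
      2 * ((c - 2 * a) * (c - 2 * (2 * c - 1 - a))) * ((1 : ℕ).factorial / poch c 1) *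
        (ha2 + hb2) +
      2 * ((c - 2 * a) * (c - 2 * (2 * c - 1 - a))) * hw0
  have expand : ∀ g : ℂ⟦X⟧, 2 * X * (1 - X ^ 2) ^ 2 * d⁄dX ℂ (d⁄dX ℂ g) +
      (1 - X ^ 2) * (2 * C c - (2 * C c + 4) * X ^ 2) * d⁄dX ℂ g +
      (C (-2 * ((c - 2 * a) * (c - 2 * b))) * (1 + X ^ 2) +
        C (4 * ((c - 2 * a) * (c - 2 * b)) - 8 * c ^ 2 + 14 * c - 8) * X +
        C (2 * c) * X ^ 3) * g =
      C 2 * (X ^ 1 * d⁄dX ℂ (d⁄dX ℂ g)) - C 4 * (X ^ 3 * d⁄dX ℂ (d⁄dX ℂ g)) +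
      C 2 * (X ^ 5 * d⁄dX ℂ (d⁄dX ℂ g)) + C (2 * c) * d⁄dX ℂ g -
      C (4 * c + 4) * (X ^ 2 * d⁄dX ℂ g) + C (2 * c + 4) * (X ^ 4 * d⁄dX ℂ g) +
      C (-2 * ((c - 2 * a) * (c - 2 * b))) * g +
      C (4 * ((c - 2 * a) * (c - 2 * b)) - 8 * c ^ 2 + 14 * c - 8) * (X ^ 1 * g) +
      C (-2 * ((c - 2 * a) * (c - 2 * b))) * (X ^ 2 * g) + C (2 * c) * (X ^ 3 * g) := by
    intro g
    have h2 : (C (2 : ℂ) : ℂ⟦X⟧) = 2 := map_ofNat C 2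
    have h4 : (C (4 : ℂ) : ℂ⟦X⟧) = 4 := map_ofNat C 4
    simp only [map_mul C, map_add C, h2, h4]
    ring
  rw [expand]
  ext n
  simp only [map_add (coeff _), map_sub (coeff _), coeff_C_mul, coeff_X_pow_mul', coeff_derivative,
    map_zero]
  rcases n with _ | _ | _ | _ | _ | n
  · norm_num [-coeff_zero_eq_constantCoeff]
    linear_combination 2 * g1 + (-2 * ((c - 2 * a) * (c - 2 * b))) * g0
  · norm_num [-coeff_zero_eq_constantCoeff]
    linear_combination g2
  · norm_num [-coeff_zero_eq_constantCoeff]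
    linear_combination g3
  · have h := hrec 0
    norm_num [-coeff_zero_eq_constantCoeff] at h ⊢
    linear_combination h
  · have h := hrec 1
    norm_num [-coeff_zero_eq_constantCoeff] at h ⊢
    linear_combination h
  · have h := hrec (n + 2)
    rw [show n + 1 + 1 + 1 + 1 + 1 - 5 = n by omega, show n + 1 + 1 + 1 + 1 + 1 - 4 = n + 1 by omega,
      show n + 1 + 1 + 1 + 1 + 1 - 3 = n + 2 by omega,
      show n + 1 + 1 + 1 + 1 + 1 - 2 = n + 3 by omega,
      show n + 1 + 1 + 1 + 1 + 1 - 1 = n + 4 by omega]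
    norm_num at h ⊢
    linear_combination h

end DeSitter

namespace DeSitter

open PowerSeries

/-! ### The hypergeometric series in the radial variable -/

/-- The left-hand side of the hypergeometric equation for `₂F₁(a, b; (d+1)/2; 4X/(1+X)²)`,
`a + b = d`, `m = ab`, in the radial variable. -/
noncomputable def radialOp (d m : ℂ) (f : ℂ⟦X⟧) : ℂ⟦X⟧ :=
  2 * X * (1 + X) ^ 2 * (1 - X) * d⁄dX ℂ (d⁄dX ℂ f) +
    (1 + X) * ((1 - X) * (1 + 3 * X) + C d * (1 - 6 * X + X ^ 2)) * d⁄dX ℂ f -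
    8 * C m * (1 - X) * f

theorem radialOp_sub (d m : ℂ) (f g : ℂ⟦X⟧) :
    radialOp d m (f - g) = radialOp d m f - radialOp d m g := by
  simp only [radialOp, map_sub]
  ring

/-- The exponents at the regular singular point 0 are `0` and `(1-d)/2`. The latter is never a
positive integer: the leading factor `(n+1)(2n+d+1)` of the recurrence does not vanish, so each
coefficient is forced by the earlier ones. -/
theorem eq_zero_of_radialOp {d : ℕ} {m : ℂ} {f : ℂ⟦X⟧} (hf : radialOp d m f = 0)
    (h0 : coeff 0 f = 0) : f = 0 := by
  have expand : radialOp d m f = 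
      C 2 * (X ^ 1 * d⁄dX ℂ (d⁄dX ℂ f)) + C 2 * (X ^ 2 * d⁄dX ℂ (d⁄dX ℂ f)) -
      C 2 * (X ^ 3 * d⁄dX ℂ (d⁄dX ℂ f)) - C 2 * (X ^ 4 * d⁄dX ℂ (d⁄dX ℂ f)) +
      C ((d : ℂ) + 1) * d⁄dX ℂ f + C (3 - 5 * (d : ℂ)) * (X ^ 1 * d⁄dX ℂ f) +
      C (-1 - 5 * (d : ℂ)) * (X ^ 2 * d⁄dX ℂ f) + C ((d : ℂ) - 3) * (X ^ 3 * d⁄dX ℂ f) -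
      C (8 * m) * f + C (8 * m) * (X ^ 1 * f) := by
    have h1 : (C (1 : ℂ) : ℂ⟦X⟧) = 1 := map_one C
    have h2 : (C (2 : ℂ) : ℂ⟦X⟧) = 2 := map_ofNat C 2
    have h3 : (C (3 : ℂ) : ℂ⟦X⟧) = 3 := map_ofNat C 3
    have h5 : (C (5 : ℂ) : ℂ⟦X⟧) = 5 := map_ofNat C 5
    have h8 : (C (8 : ℂ) : ℂ⟦X⟧) = 8 := map_ofNat C 8
    simp only [radialOp, map_mul C, map_add C, map_sub C, map_neg C, h1, h2, h3, h5, h8]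
    ring
  rw [expand] at hf
  ext n
  rw [map_zero]
  induction n using Nat.strong_induction_on with
  | _ n ih =>
    rcases n with _ | n
    · exact h0
    have h := congrArg (coeff n) hf
    simp only [map_add (coeff _), map_sub (coeff _), coeff_C_mul, coeff_X_pow_mul',
      coeff_derivative, map_zero] at h
    have key : (2 * (n : ℂ) * (n + 1) + (d + 1) * (n + 1)) * coeff (n + 1) f = 0 := by
      have z : ∀ k, k < n + 1 → coeff k f = 0 := ih
      rcases n with _ | _ | _ | _ | n
      · norm_num [-coeff_zero_eq_constantCoeff, h0] at h
        norm_num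
        exact h
      · norm_num [-coeff_zero_eq_constantCoeff, h0, z 1] at h
        push_cast
        linear_combination h
      · norm_num [z 1, z 2] at h
        push_cast
        linear_combination h
      · norm_num [z 1, z 2, z 3] at h
        push_cast
        linear_combination h
      · rw [show n + 1 + 1 + 1 + 1 - 4 = n by omega, show n + 1 + 1 + 1 + 1 - 3 = n + 1 by omega,
          show n + 1 + 1 + 1 + 1 - 2 = n + 2 by omega,
          show n + 1 + 1 + 1 + 1 - 1 = n + 3 by omega] at h
        have z2 := z (n + 2) (by omega)
        have z3 := z (n + 3) (by omega)
        have z4 := z (n + 4) (by omega)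
        simp only [add_assoc, Nat.reduceAdd, z2, z3, z4] at h ⊢
        norm_num at h
        push_cast
        linear_combination h
    have hne : (2 * (n : ℂ) * (n + 1) + (d + 1) * (n + 1)) ≠ 0 := by
      have : ((2 * n * (n + 1) + (d + 1) * (n + 1) : ℕ) : ℂ) ≠ 0 := by
        exact_mod_cast (by positivity : (2 * n * (n + 1) + (d + 1) * (n + 1) : ℕ) ≠ 0)
      exact_mod_cast this
    exact (mul_eq_zero.1 key).resolve_left hne

/-- The generating function of the coefficients `bₙ`. -/
noncomputable def bSeries (d : ℕ) (a b : ℂ) : ℂ⟦X⟧ :=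
  (1 + X) ^ d * (binomSeries (((d : ℂ) - 1) / 2) * bilinSeries a b (((d : ℂ) + 1) / 2))

theorem half_succ_add_ne_zero (d n : ℕ) : ((d : ℂ) + 1) / 2 + n ≠ 0 := by
  intro h
  have : ((d + 1 + 2 * n : ℕ) : ℂ) = 0 := by
    push_cast
    linear_combination 2 * h
  have h' : d + 1 + 2 * n = 0 := by exact_mod_cast this
  omega

theorem one_sub_X_ne_zero : (1 - X : ℂ⟦X⟧) ≠ 0 := by
  intro h
  simpa using congrArg constantCoeff h

theorem one_add_X_ne_zero : (1 + X : ℂ⟦X⟧) ≠ 0 := by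
  intro h
  simpa using congrArg constantCoeff h

/-- The prefactor `y = (1+X)^d (1-X)^(-κ)` satisfies a first-order equation, so conjugating by it
turns the equation of the bilinear series into the hypergeometric one. -/
theorem radialOp_bSeries {d : ℕ} {a b : ℂ} (hab : a + b = d) :
    radialOp d (a * b) (bSeries d a b) = 0 := by
  set κ : ℂ := ((d : ℂ) - 1) / 2 with hκ
  set c : ℂ := ((d : ℂ) + 1) / 2 with hc
  have hode := bilinSeries_ode (a := a) (b := b) (half_succ_add_ne_zero d)
    (by rw [hab]; ring)
  rw [← hc] at hode
  set g := bilinSeries a b c with hg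
  set y : ℂ⟦X⟧ := (1 + X) ^ d * binomSeries κ with hy
  have hd : (C (d : ℂ) : ℂ⟦X⟧) = 2 * C c - 1 := by
    have : (d : ℂ) = 2 * c - 1 := by rw [hc]; ring
    rw [this, map_sub, map_mul, map_one, map_ofNat C 2]
  have hκ' : (C κ : ℂ⟦X⟧) = C c - 1 := by
    have : κ = c - 1 := by rw [hc, hκ]; ring
    rw [this, map_sub, map_one]
  have hy1 : (1 - X ^ 2) * d⁄dX ℂ y = (3 * C c - 2 - C c * X) * y := by
    have h1 := derivative_binomSeries κ
    have h2 : (1 + X) * d⁄dX ℂ ((1 + X : ℂ⟦X⟧) ^ d) = C (d : ℂ) * (1 + X) ^ d := by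
      rw [derivative_pow]
      have h3 : (C (d : ℂ) : ℂ⟦X⟧) = (d : ℂ⟦X⟧) := map_natCast C d
      rcases d with _ | d
      · simp
      · rw [h3]
        simp only [map_add, derivative_X, derivative_one, Nat.add_sub_cancel, pow_succ]
        ring
    rw [hκ'] at h1
    rw [hd] at h2
    simp only [hy, Derivation.leibniz, smul_eq_mul]
    linear_combination (1 - X) * binomSeries κ * h2 + (1 + X) * (1 + X) ^ d * h1
  have hy2 : (1 - X ^ 2) * d⁄dX ℂ (d⁄dX ℂ y) =
      (3 * C c - 2 - C c * X + 2 * X) * d⁄dX ℂ y - C c * y := by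
    have h := congrArg (d⁄dX ℂ) hy1
    have e2 : d⁄dX ℂ (2 : ℂ⟦X⟧) = 0 := by rw [← map_ofNat C 2]; exact derivative_C
    have e3 : d⁄dX ℂ (3 : ℂ⟦X⟧) = 0 := by rw [← map_ofNat C 3]; exact derivative_C
    simp only [Derivation.leibniz, smul_eq_mul, map_sub, derivative_one, derivative_pow,
      derivative_X, derivative_C, e2, e3] at h
    norm_num at h
    linear_combination h
  have hK : (C (-2 * ((c - 2 * a) * (c - 2 * b))) : ℂ⟦X⟧) =
      6 * C c ^ 2 - 4 * C c - 8 * C (a * b) := by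
    rw [show -2 * ((c - 2 * a) * (c - 2 * b)) = 6 * c ^ 2 - 4 * c - 8 * (a * b) by
      have : a + b = 2 * c - 1 := by rw [hab, hc]; ring
      linear_combination 4 * c * this]
    simp only [map_sub, map_mul, map_pow, map_ofNat]
  have hM : (C (4 * ((c - 2 * a) * (c - 2 * b)) - 8 * c ^ 2 + 14 * c - 8) : ℂ⟦X⟧) =
      -20 * C c ^ 2 + 22 * C c - 8 + 16 * C (a * b) := by
    rw [show 4 * ((c - 2 * a) * (c - 2 * b)) - 8 * c ^ 2 + 14 * c - 8 =
        -20 * c ^ 2 + 22 * c - 8 + 16 * (a * b) by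
      have : a + b = 2 * c - 1 := by rw [hab, hc]; ring
      linear_combination -8 * c * this]
    simp only [map_sub, map_mul, map_pow, map_ofNat, map_add, map_neg]
  rw [hK, hM, map_mul C 2 c, map_ofNat C 2] at hode
  have hf : bSeries d a b = y * g := by rw [bSeries, hy, mul_assoc]
  have hne : (1 - X : ℂ⟦X⟧) ≠ 0 := one_sub_X_ne_zero
  -- Multiplication by `1 - X` makes the leading coefficient `2X(1-X²)²`, exactly that of the
  -- equation for `g`.
  refine (mul_eq_zero.1 ?_).resolve_left hne
  rw [hf, radialOp]
  simp only [Derivation.leibniz, smul_eq_mul, map_add]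
  rw [hd]
  generalize d⁄dX ℂ (d⁄dX ℂ y) = y2 at *
  generalize d⁄dX ℂ y = y1 at *
  generalize d⁄dX ℂ (d⁄dX ℂ g) = g2 at *
  generalize d⁄dX ℂ g = g1 at *
  generalize (C (a * b) : ℂ⟦X⟧) = m at *
  generalize (C c : ℂ⟦X⟧) = q at *
  linear_combination y * hode + 2 * X * (1 - X ^ 2) * g * hy2 +
    (4 * X * (1 - X ^ 2) * g1 +
      ((1 - X) * (1 + 3 * X) + (2 * q - 1) * (1 - 6 * X + X ^ 2)) * g +
      2 * X * (3 * q - 2 - q * X + 2 * X) * g) * hy1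

end DeSitter

/-! ### Substituting `4X/(1+X)²` into the Gauss series -/

namespace DeSitter

open PowerSeries

/-- The series of `4X/(1+X)²`. -/
noncomputable def radialZ : ℂ⟦X⟧ := 4 * X * ((1 + X)⁻¹) ^ 2

/-- The coefficients of the Gauss series `₂F₁(a, b; (a+b+1)/2; z)`. -/
noncomputable def gaussCoeff (a b : ℂ) (k : ℕ) : ℂ :=
  poch a k * poch b k / (poch ((a + b + 1) / 2) k * (k.factorial : ℂ))

/-- The series of `₂F₁(a, b; (a+b+1)/2; 4X/(1+X)²)`. -/
noncomputable def fSeries (a b : ℂ) : ℂ⟦X⟧ :=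
  (PowerSeries.mk (gaussCoeff a b)).subst radialZ

theorem one_add_X_mul_inv : (1 + X : ℂ⟦X⟧) * (1 + X)⁻¹ = 1 :=
  PowerSeries.mul_inv_cancel _ (by simp)

theorem radialZ_mul : radialZ * (1 + X) ^ 2 = 4 * X := by
  rw [radialZ]
  linear_combination 4 * X * ((1 + X) * (1 + X)⁻¹ + 1) * one_add_X_mul_inv

theorem constantCoeff_radialZ : constantCoeff radialZ = 0 := by
  simp [radialZ]

theorem hasSubst_radialZ : HasSubst radialZ :=
  HasSubst.of_constantCoeff_zero' constantCoeff_radialZ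

theorem derivative_radialZ : d⁄dX ℂ radialZ * (1 + X) ^ 3 = 4 * (1 - X) := by
  have h := congrArg (d⁄dX ℂ) radialZ_mul
  have e4 : d⁄dX ℂ (4 : ℂ⟦X⟧) = 0 := by rw [← map_ofNat C 4]; exact derivative_C
  simp only [Derivation.leibniz, smul_eq_mul, map_add, derivative_one, derivative_pow,
      derivative_X, e4] at h
  norm_num at h
  linear_combination (1 + X) * h - 2 * radialZ_mul

theorem derivative_derivative_radialZ :
    d⁄dX ℂ (d⁄dX ℂ radialZ) * (1 + X) ^ 4 = -4 * (1 + X) - 12 * (1 - X) := by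
  have h := congrArg (d⁄dX ℂ) derivative_radialZ
  have e4 : d⁄dX ℂ (4 : ℂ⟦X⟧) = 0 := by rw [← map_ofNat C 4]; exact derivative_C
  simp only [Derivation.leibniz, smul_eq_mul, map_add, map_sub, derivative_one, derivative_pow,
      derivative_X, e4] at h
  norm_num at h
  linear_combination (1 + X) * h - 3 * derivative_radialZ

theorem gaussCoeff_succ {a b : ℂ} (hc : ∀ n : ℕ, (a + b + 1) / 2 + n ≠ 0) (k : ℕ) :
    ((k : ℂ) + 1) * ((a + b + 1) / 2 + k) * gaussCoeff a b (k + 1) =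
      (a + k) * (b + k) * gaussCoeff a b k := by
  have h1 := poch_ne_zero hc k
  have h2 := hc k
  have h3 : ((k : ℂ) + 1) ≠ 0 := by exact_mod_cast k.succ_ne_zero
  have h4 : ((k.factorial : ℕ) : ℂ) ≠ 0 := by exact_mod_cast k.factorial_ne_zero
  simp only [gaussCoeff, poch_succ, Nat.factorial_succ]
  push_cast
  generalize (a + b + 1) / 2 = c at *
  field_simp

theorem gaussSeries_ode {a b : ℂ} (hc : ∀ n : ℕ, (a + b + 1) / 2 + n ≠ 0) :
    X * (1 - X) * d⁄dX ℂ (d⁄dX ℂ (PowerSeries.mk (gaussCoeff a b))) +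
      C ((a + b + 1) / 2) * (1 - 2 * X) * d⁄dX ℂ (PowerSeries.mk (gaussCoeff a b)) -
      C (a * b) * PowerSeries.mk (gaussCoeff a b) = 0 := by
  have key := gaussCoeff_succ hc
  set U := PowerSeries.mk (gaussCoeff a b) with hU
  have expand : X * (1 - X) * d⁄dX ℂ (d⁄dX ℂ U) +
      C ((a + b + 1) / 2) * (1 - 2 * X) * d⁄dX ℂ U - C (a * b) * U =
      X ^ 1 * d⁄dX ℂ (d⁄dX ℂ U) - X ^ 2 * d⁄dX ℂ (d⁄dX ℂ U) +
      C ((a + b + 1) / 2) * d⁄dX ℂ U - C (a + b + 1) * (X ^ 1 * d⁄dX ℂ U) - C (a * b) * U := by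
    have : (C (a + b + 1) : ℂ⟦X⟧) = 2 * C ((a + b + 1) / 2) := by
      rw [← map_ofNat C 2, ← map_mul]
      congr 1
      ring
    rw [this]
    ring
  rw [expand]
  ext n
  simp only [map_add (coeff _), map_sub (coeff _), coeff_C_mul, coeff_X_pow_mul',
      coeff_derivative, map_zero, hU, coeff_mk]
  have h := key n
  rcases n with _ | _ | n
  · norm_num at h ⊢
    linear_combination h
  · norm_num at h ⊢
    linear_combination h
  · rw [show n + 1 + 1 - 2 = n by omega, show n + 1 + 1 - 1 = n + 1 by omega]
    norm_num at h ⊢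
    linear_combination h

theorem derivative_fSeries_eq (a b : ℂ) : d⁄dX ℂ (fSeries a b) =
    (d⁄dX ℂ (PowerSeries.mk (gaussCoeff a b))).subst radialZ * d⁄dX ℂ radialZ :=
  derivative_subst hasSubst_radialZ

/-- Chain rule applied to the hypergeometric equation; multiplying by `(1+X)^4` lets the polynomial
identities for `z`, `z'` and `z''` replace the series themselves. -/
theorem radialOp_fSeries {d : ℕ} {a b : ℂ} (hab : a + b = d) :
    radialOp d (a * b) (fSeries a b) = 0 := by
  have hode := gaussSeries_ode (a := a) (b := b) (by rw [hab]; exact half_succ_add_ne_zero d)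
  have hs := congrArg (fun p : ℂ⟦X⟧ => p.subst radialZ) hode
  set U := PowerSeries.mk (gaussCoeff a b) with hU
  have h0 : fSeries a b = U.subst radialZ := rfl
  have h1 : d⁄dX ℂ (fSeries a b) = (d⁄dX ℂ U).subst radialZ * d⁄dX ℂ radialZ :=
    derivative_subst hasSubst_radialZ
  have h2 : d⁄dX ℂ (d⁄dX ℂ (fSeries a b)) =
      (d⁄dX ℂ (d⁄dX ℂ U)).subst radialZ * d⁄dX ℂ radialZ ^ 2 +
      (d⁄dX ℂ U).subst radialZ * d⁄dX ℂ (d⁄dX ℂ radialZ) := by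
    rw [h1, Derivation.leibniz, derivative_subst hasSubst_radialZ]
    simp only [smul_eq_mul]
    ring
  simp only [← coe_substAlgHom hasSubst_radialZ, map_add, map_sub, map_mul, map_zero, map_one,
    map_ofNat, substAlgHom_X] at hs h0 h1 h2
  have hC : ∀ r : ℂ, substAlgHom hasSubst_radialZ (C r : ℂ⟦X⟧) = C r := by
    intro r
    rw [coe_substAlgHom, subst_C]
    rfl
  rw [hC, hC, hC, hab, ← map_mul C] at hs
  rw [radialOp, h2, h1, h0]
  have hd : (C (d : ℂ) : ℂ⟦X⟧) = 2 * C (((d : ℂ) + 1) / 2) - 1 := by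
    have : (d : ℂ) = 2 * (((d : ℂ) + 1) / 2) - 1 := by ring
    conv_lhs => rw [this]
    rw [map_sub, map_mul, map_one, map_ofNat C 2]
  rw [hd]
  have z0 := radialZ_mul
  have z1 := derivative_radialZ
  have z2 := derivative_derivative_radialZ
  generalize substAlgHom hasSubst_radialZ (d⁄dX ℂ (d⁄dX ℂ U)) = U2 at *
  generalize substAlgHom hasSubst_radialZ (d⁄dX ℂ U) = U1 at *
  generalize substAlgHom hasSubst_radialZ U = U0 at *
  generalize d⁄dX ℂ (d⁄dX ℂ radialZ) = Z2 at *
  generalize d⁄dX ℂ radialZ = Z1 at *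
  generalize (C (a * b) : ℂ⟦X⟧) = m at *
  generalize (C (((d : ℂ) + 1) / 2) : ℂ⟦X⟧) = q at *
  have hne : ((1 + X : ℂ⟦X⟧)) ^ 4 ≠ 0 := pow_ne_zero _ one_add_X_ne_zero
  refine (mul_eq_zero.1 ?_).resolve_left hne
  linear_combination 8 * (1 - X) * (1 + X) ^ 4 * hs +
    2 * X * (1 - X) * U2 * (Z1 * (1 + X) ^ 3 + 4 * (1 - X)) * z1 +
    2 * X * (1 + X) ^ 2 * (1 - X) * U1 * z2 +
    (1 + X) ^ 2 * ((1 - X) * (1 + 3 * X) + (2 * q - 1) * (1 - 6 * X + X ^ 2)) * U1 * z1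
    - 8 * (1 - X) * U2 * ((1 + X) ^ 2 - radialZ * (1 + X) ^ 2 - 4 * X) * z0
    + 16 * (1 - X) * q * (1 + X) ^ 2 * U1 * z0

theorem coeff_zero_fSeries (a b : ℂ) : coeff 0 (fSeries a b) = 1 := by
  rw [fSeries, coeff_subst' hasSubst_radialZ, finsum_eq_single _ 0]
  · simp [gaussCoeff, poch_zero]
  · intro n hn
    simp [constantCoeff_radialZ, hn]

theorem coeff_zero_bSeries (d : ℕ) (a b : ℂ) : coeff 0 (bSeries d a b) = 1 := by
  have h1 := coeff_aSeries_zero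
  simp [bSeries, binomSeries, bilinSeries, poch_zero] at h1 ⊢
  rw [h1, h1, mul_one]

/-- The bilinear generating function: the coefficients `bₙ` are the coefficients of
`₂F₁(a, b; (d+1)/2; 4X/(1+X)²)`. -/
theorem bSeries_eq_fSeries {d : ℕ} {a b : ℂ} (hab : a + b = d) : bSeries d a b = fSeries a b := by
  rw [← sub_eq_zero]
  refine eq_zero_of_radialOp (d := d) (m := a * b) ?_ ?_
  · rw [radialOp_sub, radialOp_bSeries hab, radialOp_fSeries hab, sub_zero]
  · rw [map_sub, coeff_zero_bSeries, coeff_zero_fSeries, sub_self]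

/-! ### Derivative and contiguous relations -/

theorem poch_succ' (x : ℂ) (n : ℕ) : poch x (n + 1) = x * poch (x + 1) n := by
  induction n generalizing x with
  | zero => simp [poch_succ, poch_zero]
  | succ n ih =>
    rw [poch_succ, ih, poch_succ (x + 1)]
    push_cast
    ring

theorem C_mul_subst_radialZ (r : ℂ) (p : ℂ⟦X⟧) :
    C r * substAlgHom hasSubst_radialZ p = substAlgHom hasSubst_radialZ (C r * p) := by
  rw [map_mul, coe_substAlgHom, subst_C]
  rfl

theorem half_succ_ne_zero (d : ℕ) : ((d : ℂ) + 1) / 2 ≠ 0 := by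
  simpa using half_succ_add_ne_zero d 0

theorem poch_half_succ_succ_ne_zero (d k : ℕ) : poch (((d : ℂ) + 1) / 2 + 1) k ≠ 0 :=
  poch_ne_zero (fun n => by
    have := half_succ_add_ne_zero d (n + 1)
    push_cast at this
    rwa [add_assoc, add_comm (1 : ℂ)]) k

/-- Differentiating `₂F₁` in `z` raises all three parameters by one. This keeps the shape `c =
(a+b+1)/2` and amounts to `d ↦ d + 2`. -/
theorem derivative_fSeries {d : ℕ} {a b : ℂ} (hab : a + b = d) :
    (1 + X) ^ 3 * d⁄dX ℂ (fSeries a b) =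
      C (8 * a * b / (d + 1)) * ((1 - X) * fSeries (a + 1) (b + 1)) := by
  have hU : d⁄dX ℂ (PowerSeries.mk (gaussCoeff a b)) =
      C (2 * a * b / (d + 1)) * PowerSeries.mk (gaussCoeff (a + 1) (b + 1)) := by
    ext k
    rw [coeff_derivative, coeff_C_mul, coeff_mk, coeff_mk, gaussCoeff, gaussCoeff, hab,
      show (a + 1 + (b + 1) + 1) / 2 = ((d : ℂ) + 1) / 2 + 1 by rw [← hab]; ring,
      poch_succ', poch_succ', poch_succ', Nat.factorial_succ]
    have h0 := half_succ_ne_zero d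
    have h1 := poch_half_succ_succ_ne_zero d k
    have h2 : (d : ℂ) + 1 ≠ 0 := by exact_mod_cast d.succ_ne_zero
    have h3 : ((k : ℂ) + 1) ≠ 0 := by exact_mod_cast k.succ_ne_zero
    have h4 : ((k.factorial : ℕ) : ℂ) ≠ 0 := by exact_mod_cast k.factorial_ne_zero
    generalize poch (((d : ℂ) + 1) / 2 + 1) k = q at *
    push_cast
    field_simp
  rw [derivative_fSeries_eq, hU, fSeries, ← coe_substAlgHom hasSubst_radialZ,
    ← C_mul_subst_radialZ]
  have hC : (C (8 * a * b / ((d : ℂ) + 1)) : ℂ⟦X⟧) = 4 * C (2 * a * b / (d + 1)) := by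
    rw [← map_ofNat C 4, ← map_mul]
    congr 1
    ring
  rw [hC]
  linear_combination C (2 * a * b / ((d : ℂ) + 1)) *
    substAlgHom hasSubst_radialZ (PowerSeries.mk (gaussCoeff (a + 1) (b + 1))) * derivative_radialZ

/-- Contiguous relation linking `d + 2` at spectral parameters `ν` and `ν - 2` to `d` at `ν - 1`,
where `ν - 1 = (a-b)/2`. It holds term by term in `z`, before the substitution, and has nonnegative
coefficients when `a ≥ b ≥ 0`. -/
theorem fSeries_contiguous {d : ℕ} {a b : ℂ} (hab : a + b = d) :
    C (a * (a + 1)) * fSeries (a + 2) b =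
      C ((a - b) * (d + 1)) * fSeries a b + C (b * (b + 1)) * fSeries a (b + 2) := by
  have hc := half_succ_add_ne_zero d
  simp only [fSeries, ← coe_substAlgHom hasSubst_radialZ]
  rw [C_mul_subst_radialZ, C_mul_subst_radialZ, C_mul_subst_radialZ, ← map_add]
  congr 1
  ext k
  simp only [map_add, coeff_C_mul, coeff_mk, gaussCoeff]
  have e1 : (a + 2 + b + 1) / 2 = ((d : ℂ) + 1) / 2 + 1 := by rw [← hab]; ring
  have e2 : (a + (b + 2) + 1) / 2 = ((d : ℂ) + 1) / 2 + 1 := by rw [← hab]; ring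
  rw [e1, e2, hab]
  have hq : ((d : ℂ) + 1) / 2 * poch (((d : ℂ) + 1) / 2 + 1) k =
      poch (((d : ℂ) + 1) / 2) k * (((d : ℂ) + 1) / 2 + k) := by rw [← poch_succ', poch_succ]
  have h2 : ∀ x : ℂ, x * (x + 1) * poch (x + 2) k = poch x k * (x + k) * (x + k + 1) := by
    intro x
    have h3 : x * (x + 1) * poch (x + 2) k = poch x (k + 2) := by
      rw [poch_succ', poch_succ', show x + 1 + 1 = x + 2 by ring]; ring
    rw [h3, poch_succ, poch_succ]
    push_cast
    ring
  have ha := h2 a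
  have hb := h2 b
  have hne0 := hc 0
  have hne1 := hc k
  have hne2 := poch_ne_zero hc k
  have hne3 := poch_half_succ_succ_ne_zero d k
  have hd : (d : ℂ) + 1 = 2 * (((d : ℂ) + 1) / 2) := by ring
  have hab' : a + b = 2 * (((d : ℂ) + 1) / 2) - 1 := by rw [hab]; ring
  have hfac : ((k.factorial : ℕ) : ℂ) ≠ 0 := by exact_mod_cast k.factorial_ne_zero
  rw [hd, mul_div_cancel_left₀ _ (two_ne_zero' ℂ)]
  generalize ((d : ℂ) + 1) / 2 = c at *
  rw [Nat.cast_zero, add_zero] at hne0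
  have goal' : a * (a + 1) * poch (a + 2) k * poch b k * poch c k =
      (a - b) * (2 * c) * poch a k * poch b k * poch (c + 1) k +
      b * (b + 1) * poch a k * poch (b + 2) k * poch c k := by
    refine mul_left_cancel₀ hne0 ?_
    linear_combination (c * poch b k * poch c k) * ha - (c * poch a k * poch c k) * hb
      - (a - b) * (2 * c) * poch a k * poch b k * hq + c * poch a k * poch b k * poch c k * (a - b) * hab'
  field_simp
  linear_combination goal'

end DeSitter

namespace DeSitter

open PowerSeries
open scoped ComplexOrder

/-! ### Positivity of the coefficients -/

/-- All coefficients are real and nonnegative. -/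
def NonnegCoeffs (p : ℂ⟦X⟧) : Prop := ∀ n, 0 ≤ coeff n p

theorem NonnegCoeffs.mul {p q : ℂ⟦X⟧} (hp : NonnegCoeffs p) (hq : NonnegCoeffs q) :
    NonnegCoeffs (p * q) := by
  intro n
  rw [coeff_mul]
  exact Finset.sum_nonneg fun i _ => mul_nonneg (hp _) (hq _)

theorem NonnegCoeffs.add {p q : ℂ⟦X⟧} (hp : NonnegCoeffs p) (hq : NonnegCoeffs q) :
    NonnegCoeffs (p + q) := by
  intro n
  rw [map_add]
  exact add_nonneg (hp _) (hq _)

theorem NonnegCoeffs.C_mul {p : ℂ⟦X⟧} {r : ℂ} (hr : 0 ≤ r) (hp : NonnegCoeffs p) :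
    NonnegCoeffs (C r * p) := by
  intro n
  rw [coeff_C_mul]
  exact mul_nonneg hr (hp _)

theorem nonnegCoeffs_one_add_X_pow (k : ℕ) : NonnegCoeffs ((1 + X) ^ k) := by
  induction k with
  | zero =>
    intro n
    rw [pow_zero, coeff_one]
    split_ifs <;> simp
  | succ k ih =>
    rw [pow_succ]
    refine ih.mul ?_
    intro n
    rw [map_add, coeff_one, coeff_X]
    exact add_nonneg (by split_ifs <;> simp) (by split_ifs <;> simp)

theorem poch_nonneg {x : ℂ} (hx : 0 ≤ x) (n : ℕ) : 0 ≤ poch x n := by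
  induction n with
  | zero => simp [poch_zero]
  | succ n ih =>
    rw [poch_succ]
    exact mul_nonneg ih (add_nonneg hx (Nat.cast_nonneg n))

theorem nonnegCoeffs_binomSeries {x : ℂ} (hx : 0 ≤ x) : NonnegCoeffs (binomSeries x) := by
  intro n
  rw [binomSeries, coeff_mk]
  exact div_nonneg (poch_nonneg hx n) (Nat.cast_nonneg _)

theorem half_pred_nonneg {d : ℕ} (hd : 1 ≤ d) : (0 : ℂ) ≤ ((d : ℂ) - 1) / 2 := by
  have : (0 : ℝ) ≤ ((d : ℝ) - 1) / 2 := by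
    have : (1 : ℝ) ≤ d := by exact_mod_cast hd
    linarith
  simpa using Complex.zero_le_real.2 this

theorem half_succ_nonneg (d : ℕ) : (0 : ℂ) ≤ ((d : ℂ) + 1) / 2 := by
  have : (0 : ℝ) ≤ ((d : ℝ) + 1) / 2 := by positivity
  simpa using Complex.zero_le_real.2 this

theorem nonnegCoeffs_bilinSeries {a b c : ℂ} (hc : 0 ≤ c)
    (h : ∀ m, 0 ≤ coeff m (aSeries (c - a) a) * coeff m (aSeries (c - b) b)) :
    NonnegCoeffs (bilinSeries a b c) := by
  intro m
  rw [coeff_bilinSeries]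
  exact mul_nonneg (div_nonneg (Nat.cast_nonneg _) (poch_nonneg hc m)) (h m)

theorem star_poch (x : ℂ) (n : ℕ) : star (poch x n) = poch (star x) n := by
  induction n with
  | zero => simp [poch_zero]
  | succ n ih => rw [poch_succ, poch_succ, star_mul', ih]; simp

theorem star_coeff_aSeries (p q : ℂ) (n : ℕ) :
    star (coeff n (aSeries p q)) = coeff n (aSeries (star p) (star q)) := by
  simp only [aSeries, coeff_mul, star_sum, star_mul', altBinomSeries, binomSeries, coeff_mk,
    star_div₀, star_poch, star_pow, star_neg, star_one, star_natCast]

/-- The two factors in each bilinear term are complex conjugates, so the term is a nonnegative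
weight times a squared modulus. -/
theorem nonnegCoeffs_bSeries_of_star {d : ℕ} (hd : 1 ≤ d) {a b : ℂ} (hb : b = star a) :
    NonnegCoeffs (bSeries d a b) := by
  refine (nonnegCoeffs_one_add_X_pow d).mul ((nonnegCoeffs_binomSeries (half_pred_nonneg hd)).mul
    (nonnegCoeffs_bilinSeries (half_succ_nonneg d) fun m => ?_))
  have hc : star (((d : ℂ) + 1) / 2) = ((d : ℂ) + 1) / 2 := by simp
  have : coeff m (aSeries (((d : ℂ) + 1) / 2 - b) b) =
      star (coeff m (aSeries (((d : ℂ) + 1) / 2 - a) a)) := by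
    rw [star_coeff_aSeries, star_sub, hc, hb]
  rw [this]
  exact mul_star_self_nonneg _

theorem one_sub_X_mul_binomSeries (α : ℂ) :
    (1 - X) * binomSeries (α + 1) = binomSeries α := by
  ext n
  rcases n with _ | n
  · simp [sub_mul, binomSeries, poch_zero]
  · have h3 : ((n : ℂ) + 1) ≠ 0 := by exact_mod_cast n.succ_ne_zero
    have h4 : ((n.factorial : ℕ) : ℂ) ≠ 0 := by exact_mod_cast n.factorial_ne_zero
    rw [sub_mul, one_mul, map_sub, coeff_succ_X_mul]
    simp only [binomSeries, coeff_mk]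
    rw [poch_succ' α, poch_succ (α + 1), Nat.factorial_succ]
    push_cast
    field_simp
    ring

/-- After the signs are absorbed, the three-term recurrence has the nonnegative coefficients `q - p`
and `n + p + q`. -/
theorem alternating_coeff_aSeries {p q : ℝ} (h1 : p ≤ q) (h2 : 0 ≤ p + q) (n : ℕ) :
    (0 : ℂ) ≤ (-1) ^ n * coeff n (aSeries p q) := by
  have h1' : (0 : ℂ) ≤ (q : ℂ) - p := by exact_mod_cast sub_nonneg.2 h1
  have h2' : (0 : ℂ) ≤ (p : ℂ) + q := by exact_mod_cast h2
  induction n using Nat.twoStepInduction with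
  | zero => rw [coeff_aSeries_zero]; simp
  | one => rw [coeff_aSeries_one]; simpa using h1'
  | more n ih0 ih1 =>
    have hne : ((n : ℂ) + 2) ≠ 0 := by exact_mod_cast (n + 1).succ_ne_zero
    have hn : (0 : ℂ) ≤ ((n : ℂ) + 2)⁻¹ := by
      have : (0 : ℝ) ≤ ((n : ℝ) + 2)⁻¹ := by positivity
      simpa using Complex.zero_le_real.2 this
    have hrec := coeff_aSeries_succ_succ p q n
    have : (-1) ^ (n + 2) * coeff (n + 2) (aSeries p q) = ((n : ℂ) + 2)⁻¹ *
        ((q - p) * ((-1) ^ (n + 1) * coeff (n + 1) (aSeries p q)) +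
          (n + (p + q)) * ((-1) ^ n * coeff n (aSeries p q))) := by
      rw [eq_inv_mul_iff_mul_eq₀ hne]
      linear_combination (-1) ^ n * hrec
    rw [this]
    exact mul_nonneg hn (add_nonneg (mul_nonneg h1' ih1)
      (mul_nonneg (add_nonneg (Nat.cast_nonneg n) h2') ih0))

theorem nonnegCoeffs_of_derivative {f : ℂ⟦X⟧} (h0 : 0 ≤ coeff 0 f)
    (h : NonnegCoeffs (d⁄dX ℂ f)) : NonnegCoeffs f := by
  intro n
  rcases n with _ | n
  · exact h0
  · have h1 := h n
    rw [coeff_derivative] at h1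
    have hne : ((n : ℂ) + 1) ≠ 0 := by exact_mod_cast n.succ_ne_zero
    have hn : (0 : ℂ) ≤ ((n : ℂ) + 1)⁻¹ := by
      have : (0 : ℝ) ≤ ((n : ℝ) + 1)⁻¹ := by positivity
      simpa using Complex.zero_le_real.2 this
    have := mul_nonneg h1 hn
    rwa [mul_inv_cancel_right₀ hne] at this

/-- The bound `a ≤ 3b + 1`, that is `ν ≤ (d+1)/4`, is what makes both coefficient sequences in
dimension `d + 2` alternate, so that their products are nonnegative. The factor `(1-X)/(1+X)³` of
the derivative is harmless: it only lowers the exponents of the prefactor to `(1+X)^(d-1)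
(1-X)^(-(d-1)/2)`. -/
theorem nonnegCoeffs_fSeries_of_le {d : ℕ} (hd : 1 ≤ d) {a b : ℝ} (hab : a + b = d) (hb : 0 ≤ b)
    (hba : b ≤ a) (h : a ≤ 3 * b + 1) : NonnegCoeffs (fSeries a b) := by
  have habC : (a : ℂ) + b = d := by exact_mod_cast hab
  have hder := derivative_fSeries habC
  have hab2 : ((a : ℂ) + 1) + (b + 1) = ((d + 2 : ℕ) : ℂ) := by
    push_cast
    linear_combination habC
  have hbin : (1 - X) * binomSeries (((d + 2 : ℕ) - 1 : ℂ) / 2) =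
      binomSeries (((d : ℂ) - 1) / 2) := by
    rw [← one_sub_X_mul_binomSeries (((d : ℂ) - 1) / 2)]
    congr 2
    push_cast
    ring
  have hder' : d⁄dX ℂ (fSeries a b) = C (8 * a * b / ((d : ℂ) + 1)) * ((1 + X) ^ (d - 1) *
      (binomSeries (((d : ℂ) - 1) / 2) *
        bilinSeries ((a : ℂ) + 1) (b + 1) ((((d + 2 : ℕ) : ℂ) + 1) / 2))) := by
    refine mul_left_cancel₀ (pow_ne_zero 3 one_add_X_ne_zero) ?_
    rw [hder, ← bSeries_eq_fSeries hab2, bSeries, ← hbin]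
    obtain ⟨e, rfl⟩ : ∃ e, d = e + 1 := ⟨d - 1, by omega⟩
    rw [Nat.add_sub_cancel]
    ring
  refine nonnegCoeffs_of_derivative (by rw [coeff_zero_fSeries]; exact zero_le_one) ?_
  rw [hder']
  have ha : 0 ≤ a := hb.trans hba
  refine NonnegCoeffs.C_mul ?_ ((nonnegCoeffs_one_add_X_pow _).mul
    ((nonnegCoeffs_binomSeries (half_pred_nonneg hd)).mul
      (nonnegCoeffs_bilinSeries (half_succ_nonneg _) fun m => ?_)))
  · have : 0 ≤ 8 * a * b / ((d : ℝ) + 1) := by positivity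
    exact_mod_cast this
  · have h1 := alternating_coeff_aSeries (p := ((d : ℝ) + 3) / 2 - (a + 1)) (q := a + 1)
      (by rw [← hab]; linarith) (by rw [← hab]; linarith) m
    have h2 := alternating_coeff_aSeries (p := ((d : ℝ) + 3) / 2 - (b + 1)) (q := b + 1)
      (by rw [← hab]; linarith) (by rw [← hab]; linarith) m
    have h3 := mul_nonneg h1 h2
    have hs : ((-1 : ℂ) ^ m) * (-1) ^ m = 1 := by rw [← mul_pow]; simp
    have hc : (((d + 2 : ℕ) : ℂ) + 1) / 2 = ((d : ℂ) + 3) / 2 := by push_cast; ring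
    rw [hc]
    push_cast at h3
    rwa [mul_mul_mul_comm, hs, one_mul] at h3

end DeSitter

namespace DeSitter

open PowerSeries
open scoped ComplexOrder

/-! ### The case `d = 2` -/

/-- The coefficients of `(1 + t)^(2 + μ) (1 - t)^(2 - μ)`. -/
noncomputable def quarticCoeff (μ : ℝ) : ℕ → ℝ
  | 0 => 1
  | 1 => 2 * μ
  | n + 2 => (2 * μ * quarticCoeff μ (n + 1) + ((n : ℝ) - 4) * quarticCoeff μ n) / (n + 2)

theorem quarticCoeff_rec (μ : ℝ) (n : ℕ) : ((n : ℝ) + 2) * quarticCoeff μ (n + 2) =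
    2 * μ * quarticCoeff μ (n + 1) + ((n : ℝ) - 4) * quarticCoeff μ n := by
  rw [quarticCoeff]
  field_simp

theorem quarticCoeff_three (μ : ℝ) : quarticCoeff μ 3 = 2 * μ * (2 * μ ^ 2 - 5) / 3 := by
  simp [quarticCoeff]
  ring

theorem quarticCoeff_five (μ : ℝ) :
    quarticCoeff μ 5 = 4 * μ * (μ ^ 2 - 1) * (μ ^ 2 - 4) / 15 := by
  simp [quarticCoeff]
  ring

/-- From index 5 on the coefficients are nonpositive, with consecutive ratios between `μ/3` and
`3/μ`. The induction starts at 5 because the factor `n - 4` of the recurrence vanishes there, giving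
`y₆ = (μ/3) y₅`, and is positive afterwards. -/
theorem quarticCoeff_bounds {μ : ℝ} (h1 : 1 ≤ μ) (h2 : μ < 2) (n : ℕ) :
    quarticCoeff μ (n + 5) ≤ 0 ∧ 3 * quarticCoeff μ (n + 6) ≤ μ * quarticCoeff μ (n + 5) ∧
      3 * quarticCoeff μ (n + 5) ≤ μ * quarticCoeff μ (n + 6) := by
  induction n with
  | zero =>
    have h6 := quarticCoeff_rec μ 4
    have h5 : quarticCoeff μ 5 ≤ 0 := by
      rw [quarticCoeff_five]
      have : 0 ≤ 4 * μ * (μ ^ 2 - 1) * (4 - μ ^ 2) :=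
        mul_nonneg (mul_nonneg (by linarith) (by nlinarith)) (by nlinarith)
      linarith
    norm_num at h6 ⊢
    have h6' : quarticCoeff μ 6 = μ / 3 * quarticCoeff μ 5 := by linarith
    refine ⟨h5, by rw [h6']; linarith, ?_⟩
    rw [h6']
    have hsq : μ ^ 2 ≤ 9 := by nlinarith
    nlinarith [mul_le_mul_of_nonpos_right hsq h5]
  | succ n ih =>
    obtain ⟨i0, i1, i2⟩ := ih
    have h7 := quarticCoeff_rec μ (n + 5)
    push_cast at h7
    rw [show n + 5 + 2 = n + 1 + 6 by ring, show n + 5 + 1 = n + 1 + 5 by ring] at h7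
    rw [show n + 6 = n + 1 + 5 by ring] at i1 i2
    have hn : (0 : ℝ) ≤ n := Nat.cast_nonneg n
    have i0' : quarticCoeff μ (n + 1 + 5) ≤ 0 := by nlinarith
    refine ⟨i0', ?_, ?_⟩
    · have : ((n : ℝ) + 5 + 2) * (3 * quarticCoeff μ (n + 1 + 6)) ≤
          ((n : ℝ) + 5 + 2) * (μ * quarticCoeff μ (n + 1 + 5)) := by
        nlinarith [mul_le_mul_of_nonneg_left i2 (by linarith : (0 : ℝ) ≤ n + 1)]
      exact le_of_mul_le_mul_left this (by positivity)
    · have : ((n : ℝ) + 5 + 2) * (3 * quarticCoeff μ (n + 1 + 5)) ≤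
          ((n : ℝ) + 5 + 2) * (μ * quarticCoeff μ (n + 1 + 6)) := by
        have e : ((n : ℝ) + 5 + 2) * (μ * quarticCoeff μ (n + 1 + 6)) =
            2 * μ ^ 2 * quarticCoeff μ (n + 1 + 5) +
              (n + 1) * (μ * quarticCoeff μ (n + 5)) := by linear_combination μ * h7
        rw [e]
        have e1 := mul_le_mul_of_nonneg_left i1 (by linarith : (0 : ℝ) ≤ n + 1)
        have e2 : 2 * μ ^ 2 ≤ 18 := by nlinarith
        nlinarith [mul_le_mul_of_nonpos_right e2 i0']
      exact le_of_mul_le_mul_left this (by positivity)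

/-- Since these coefficients are nonpositive, this says that absolute values decrease along steps of
two. -/
theorem quarticCoeff_antitone {μ : ℝ} (h1 : 1 ≤ μ) (h2 : μ < 2) (n : ℕ) :
    quarticCoeff μ (n + 5) ≤ quarticCoeff μ (n + 7) := by
  obtain ⟨i0, i1, i2⟩ := quarticCoeff_bounds h1 h2 n
  have h7 := quarticCoeff_rec μ (n + 5)
  push_cast at h7
  rw [show n + 5 + 2 = n + 7 by ring, show n + 5 + 1 = n + 6 by ring] at h7
  have : ((n : ℝ) + 5 + 2) * quarticCoeff μ (n + 5) ≤
      ((n : ℝ) + 5 + 2) * quarticCoeff μ (n + 7) := by nlinarith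
  exact le_of_mul_le_mul_left this (by positivity)

/-- Alternating partial sums of the odd coefficients. -/
noncomputable def quarticSum (μ : ℝ) (n : ℕ) : ℝ :=
  ∑ k ∈ Finset.range (n + 1), (-1) ^ k * quarticCoeff μ (2 * k + 1)

theorem quarticSum_succ (μ : ℝ) (n : ℕ) : quarticSum μ (n + 1) =
    quarticSum μ n + (-1) ^ (n + 1) * quarticCoeff μ (2 * (n + 1) + 1) :=
  Finset.sum_range_succ _ _

/-- Leibniz's argument: past `S₂`, the even partial sums grow by `y₄ⱼ₊₉ - y₄ⱼ₊₇ ≥ 0`, and each odd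
one adds a term `-y₄ⱼ₊₇ ≥ 0`. The sums `S₀`, `S₁`, `S₂` are explicit, with factors `4 - μ²` and `6 -
μ²`. -/
theorem quarticSum_nonneg {μ : ℝ} (h1 : 1 ≤ μ) (h2 : μ < 2) (n : ℕ) : 0 ≤ quarticSum μ n := by
  have s0 : quarticSum μ 0 = 2 * μ := by simp [quarticSum, quarticCoeff]
  have s1 : quarticSum μ 1 = 4 * μ * (4 - μ ^ 2) / 3 := by
    rw [quarticSum_succ, s0]
    norm_num
    rw [quarticCoeff_three]
    ring
  have s2 : quarticSum μ 2 = 4 * μ * (4 - μ ^ 2) * (6 - μ ^ 2) / 15 := by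
    rw [quarticSum_succ, s1]
    norm_num
    rw [quarticCoeff_five]
    ring
  have hsq : μ ^ 2 < 4 := by nlinarith
  have key : ∀ j, 0 ≤ quarticSum μ (2 * j + 2) := by
    intro j
    induction j with
    | zero =>
      rw [mul_zero, zero_add, s2]
      have := mul_nonneg (mul_nonneg (by linarith : 0 ≤ 4 * μ) (by linarith : 0 ≤ 4 - μ ^ 2))
        (by linarith : 0 ≤ 6 - μ ^ 2)
      linarith
    | succ j ih =>
      have e1 := quarticSum_succ μ (2 * j + 2)
      have e2 := quarticSum_succ μ (2 * j + 2 + 1)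
      have p1 : (-1 : ℝ) ^ (2 * j + 2 + 1) = -1 := Odd.neg_one_pow ⟨j + 1, by ring⟩
      have p2 : (-1 : ℝ) ^ (2 * j + 2 + 1 + 1) = 1 := Even.neg_one_pow ⟨j + 2, by ring⟩
      have m := quarticCoeff_antitone h1 h2 (4 * j + 2)
      rw [p1, show 2 * (2 * j + 2 + 1) + 1 = 4 * j + 2 + 5 by ring] at e1
      rw [p2, show 2 * (2 * j + 2 + 1 + 1) + 1 = 4 * j + 2 + 7 by ring] at e2
      rw [show 2 * (j + 1) + 2 = 2 * j + 2 + 1 + 1 by ring, e2, e1]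
      linarith
  rcases Nat.even_or_odd' n with ⟨j, rfl | rfl⟩
  · rcases j with _ | j
    · rw [mul_zero, s0]; linarith
    · exact key j
  · rcases j with _ | j
    · rw [mul_zero, zero_add, s1]
      have := mul_nonneg (by linarith : 0 ≤ 4 * μ) (by linarith : 0 ≤ 4 - μ ^ 2)
      linarith
    · rw [show 2 * (j + 1) + 1 = 2 * j + 2 + 1 by ring, quarticSum_succ]
      have p1 : (-1 : ℝ) ^ (2 * j + 2 + 1) = -1 := Odd.neg_one_pow ⟨j + 1, by ring⟩
      have hb := (quarticCoeff_bounds h1 h2 (4 * j + 2)).1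
      rw [p1, show 2 * (2 * j + 2 + 1) + 1 = 4 * j + 2 + 5 by ring]
      linarith [key j]

/-- `∑ (-1)ᵏ y₂ₖ₊₁ Xᵏ` for the coefficients `y` of `(1 + t)^(2 + μ) (1 - t)^(2 - μ)`. -/
noncomputable def oddQuarticSeries (μ : ℝ) : ℂ⟦X⟧ :=
  PowerSeries.mk fun k => (((-1) ^ k * quarticCoeff μ (2 * k + 1) : ℝ) : ℂ)

/-- Elimination of the even-indexed coefficients from three consecutive recurrences. -/
theorem oddQuartic_rec (μ : ℝ) (k : ℕ) :
    (2 * (k : ℝ) + 5) * (2 * k + 4) * quarticCoeff μ (2 * k + 5) =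
      (4 * μ ^ 2 + (8 * k ^ 2 + 8 * k - 10)) * quarticCoeff μ (2 * k + 3) -
        (2 * k - 2) * (2 * k - 3) * quarticCoeff μ (2 * k + 1) := by
  have r1 := quarticCoeff_rec μ (2 * k + 3)
  have r2 := quarticCoeff_rec μ (2 * k + 2)
  have r3 := quarticCoeff_rec μ (2 * k + 1)
  push_cast at r1 r2 r3
  rw [show 2 * k + 3 + 2 = 2 * k + 5 by ring, show 2 * k + 3 + 1 = 2 * k + 4 by ring] at r1
  rw [show 2 * k + 2 + 2 = 2 * k + 4 by ring, show 2 * k + 2 + 1 = 2 * k + 3 by ring] at r2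
  rw [show 2 * k + 1 + 2 = 2 * k + 3 by ring, show 2 * k + 1 + 1 = 2 * k + 2 by ring] at r3
  linear_combination (2 * (k : ℝ) + 4) * r1 + 2 * μ * r2 - (2 * (k : ℝ) - 2) * r3

theorem oddQuarticSeries_ode (μ : ℝ) :
    4 * X * (1 + X) ^ 2 * d⁄dX ℂ (d⁄dX ℂ (oddQuarticSeries μ)) +
      6 * (1 - X ^ 2) * d⁄dX ℂ (oddQuarticSeries μ) +
      (C (4 * (μ : ℂ) ^ 2 - 10) + 6 * X) * oddQuarticSeries μ = 0 := by
  have hrec := oddQuartic_rec μ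
  have h4 : (C (4 : ℂ) : ℂ⟦X⟧) = 4 := map_ofNat C 4
  have h6 : (C (6 : ℂ) : ℂ⟦X⟧) = 6 := map_ofNat C 6
  have h8 : (C (8 : ℂ) : ℂ⟦X⟧) = 8 := map_ofNat C 8
  have expand : ∀ g : ℂ⟦X⟧, 4 * X * (1 + X) ^ 2 * d⁄dX ℂ (d⁄dX ℂ g) +
      6 * (1 - X ^ 2) * d⁄dX ℂ g + (C (4 * (μ : ℂ) ^ 2 - 10) + 6 * X) * g =
      C 4 * (X ^ 1 * d⁄dX ℂ (d⁄dX ℂ g)) + C 8 * (X ^ 2 * d⁄dX ℂ (d⁄dX ℂ g)) +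
      C 4 * (X ^ 3 * d⁄dX ℂ (d⁄dX ℂ g)) + C 6 * d⁄dX ℂ g - C 6 * (X ^ 2 * d⁄dX ℂ g) +
      C (4 * (μ : ℂ) ^ 2 - 10) * g + C 6 * (X ^ 1 * g) := by
    intro g
    rw [h4, h6, h8]
    ring
  rw [expand]
  ext n
  simp only [map_add (coeff _), map_sub (coeff _), coeff_C_mul, coeff_X_pow_mul',
      coeff_derivative, map_zero, oddQuarticSeries, coeff_mk]
  rcases n with _ | n
  · norm_num
    rw [quarticCoeff_three, quarticCoeff]
    push_cast
    ring
  · have h := congrArg (fun x : ℝ => (x : ℂ)) (hrec n)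
    push_cast at h
    rcases n with _ | _ | n
    · norm_num at h ⊢
      linear_combination h
    · norm_num at h ⊢
      linear_combination -h
    · rw [show n + 1 + 1 + 1 - 3 = n by omega, show n + 1 + 1 + 1 - 2 = n + 1 by omega,
        show n + 1 + 1 + 1 - 1 = n + 2 by omega]
      have e1 : 2 * (n + 1 + 1) + 5 = 2 * (n + 1 + 1 + 1 + 1) + 1 := by ring
      have e2 : 2 * (n + 1 + 1) + 3 = 2 * (n + 1 + 1 + 1) + 1 := by ring
      rw [e1, e2] at h
      norm_num at h ⊢
      linear_combination (-1) ^ n * h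

/-- For `d = 2` and `z = sin²θ` the function is `sin(2νθ) / (ν sin 2θ)`. Since `θ = 2 arctan √X`,
multiplying by `4ν(1-X)` gives the odd part of `(1+t)^(2+2ν) (1-t)^(2-2ν)` divided by `t`, at `t² =
-X`. Dividing by `1 - X` forms partial sums. The proof compares the equations and constant terms of
the two sides. -/
theorem fSeries_two {ν : ℝ} :
    C (4 * (ν : ℂ)) * fSeries (1 + ν) (1 - ν) =
      PowerSeries.mk fun n => ((quarticSum (2 * ν) n : ℝ) : ℂ) := by
  have hab : (1 + (ν : ℂ)) + (1 - ν) = ((2 : ℕ) : ℂ) := by push_cast; ring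
  set p : ℂ⟦X⟧ := PowerSeries.mk fun n => ((quarticSum (2 * ν) n : ℝ) : ℂ) with hp
  have hg : oddQuarticSeries (2 * ν) = (1 - X) * p := by
    ext n
    rcases n with _ | n
    · simp [oddQuarticSeries, sub_mul, hp, quarticSum]
    · rw [sub_mul, one_mul, map_sub, coeff_succ_X_mul, hp, coeff_mk, coeff_mk, quarticSum_succ,
        oddQuarticSeries, coeff_mk]
      push_cast
      ring
  have hode := oddQuarticSeries_ode (2 * ν)
  rw [← sub_eq_zero]
  refine eq_zero_of_radialOp (d := 2) (m := (1 + ν) * (1 - ν)) ?_ ?_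
  · have hf : radialOp ((2 : ℕ) : ℂ) ((1 + ν) * (1 - ν)) (C (4 * (ν : ℂ)) * fSeries (1 + ν) (1 - ν))
        = 0 := by
      have h := radialOp_fSeries hab
      have : radialOp ((2 : ℕ) : ℂ) ((1 + ν) * (1 - ν))
          (C (4 * (ν : ℂ)) * fSeries (1 + ν) (1 - ν)) = C (4 * (ν : ℂ)) *
          radialOp ((2 : ℕ) : ℂ) ((1 + ν) * (1 - ν)) (fSeries (1 + ν) (1 - ν)) := by
        simp only [radialOp, Derivation.leibniz, smul_eq_mul, derivative_C, mul_zero, add_zero]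
        ring
      rw [this, h, mul_zero]
    have hp0 : radialOp ((2 : ℕ) : ℂ) ((1 + ν) * (1 - ν)) p = 0 := by
      have hne : (2 : ℂ⟦X⟧) ≠ 0 := by
        intro h
        have h' := congrArg constantCoeff h
        rw [map_ofNat, map_zero] at h'
        exact two_ne_zero h'
      refine (mul_eq_zero.1 ?_).resolve_left hne
      rw [hg] at hode
      simp only [Derivation.leibniz, smul_eq_mul, map_sub, map_add, derivative_one,
        derivative_X, map_zero] at hode
      have hC : (C (4 * (((2 * ν : ℝ) : ℂ)) ^ 2) - C 10 : ℂ⟦X⟧) =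
          6 - 16 * C ((1 + (ν : ℂ)) * (1 - ν)) := by
        rw [← map_sub, ← map_ofNat C 6, ← map_ofNat C 16, ← map_mul, ← map_sub]
        congr 1
        push_cast
        ring
      have h2 : (C ((2 : ℕ) : ℂ) : ℂ⟦X⟧) = 2 := by
        rw [Nat.cast_ofNat]
        exact map_ofNat C 2
      rw [radialOp, h2]
      rw [hC] at hode
      linear_combination hode
    rw [radialOp_sub, hf, hp0, sub_zero]
  · rw [map_sub, coeff_C_mul, coeff_zero_fSeries, hp, coeff_mk]
    simp [quarticSum, quarticCoeff]
    ring

theorem nonnegCoeffs_fSeries_two {ν : ℝ} (h1 : 1 / 2 ≤ ν) (h2 : ν < 1) :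
    NonnegCoeffs (fSeries (1 + ν) (1 - ν)) := by
  intro n
  have h := congrArg (coeff n) (fSeries_two (ν := ν))
  rw [coeff_C_mul, coeff_mk] at h
  have hs := quarticSum_nonneg (μ := 2 * ν) (by linarith) (by linarith) n
  have hν : (4 * (ν : ℂ)) ≠ 0 := by
    have : 4 * ν ≠ 0 := by linarith
    exact_mod_cast this
  have : coeff n (fSeries (1 + ν) (1 - ν)) = ((quarticSum (2 * ν) n / (4 * ν) : ℝ) : ℂ) := by
    push_cast
    rw [eq_div_iff hν, ← h]
    ring
  rw [this]
  have : 0 ≤ quarticSum (2 * ν) n / (4 * ν) := div_nonneg hs (by linarith)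
  exact_mod_cast this

/-! ### All dimensions -/

theorem fSeries_comm (a b : ℂ) : fSeries a b = fSeries b a := by
  have : gaussCoeff a b = gaussCoeff b a := by
    funext k
    rw [gaussCoeff, gaussCoeff, mul_comm (poch a k), add_comm a b]
  rw [fSeries, fSeries, this]

/-- Positivity in the complementary series. -/
theorem nonnegCoeffs_fSeries (d : ℕ) (hd : 1 ≤ d) (ν : ℝ) (h0 : 0 ≤ ν) (h1 : ν < (d : ℝ) / 2) :
    NonnegCoeffs (fSeries ((d / 2 + ν : ℝ) : ℂ) ((d / 2 - ν : ℝ) : ℂ)) := by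
  induction d using Nat.strong_induction_on generalizing ν with
  | _ d ih =>
    -- This range is everything for `d = 1` and contains `ν ≤ 1` for `d ≥ 3`; for `d = 2` it stops
    -- at `3/4`.
    have base : ∀ ν : ℝ, 0 ≤ ν → ν < (d : ℝ) / 2 → ν ≤ ((d : ℝ) + 1) / 4 →
        NonnegCoeffs (fSeries ((d / 2 + ν : ℝ) : ℂ) ((d / 2 - ν : ℝ) : ℂ)) := fun ν h0 h1 h2 =>
      nonnegCoeffs_fSeries_of_le hd (by ring) (by linarith) (by linarith) (by linarith)
    rcases lt_or_ge d 3 with hd3 | hd3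
    · rcases le_or_gt ν (((d : ℝ) + 1) / 4) with hν | hν
      · exact base ν h0 h1 hν
      · have hd2 : d = 2 := by
          by_contra hne
          have : d = 1 := by omega
          subst this
          norm_num at hν h1
          linarith
        subst hd2
        norm_num at hν h1 ⊢
        exact nonnegCoeffs_fSeries_two (by linarith) h1
    · have hd3' : (3 : ℝ) ≤ d := by exact_mod_cast hd3
      -- Inner induction on the size of `ν` at fixed `d`. For `ν > 1` the contiguous relation calls
      -- on `(d-2, ν-1)`, from the outer induction, and on `(d, ν-2)`; for `ν < 2` the latter is
      -- reflected to `2 - ν` by the symmetry in `a, b`.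
      have step : ∀ k : ℕ, ∀ ν : ℝ, 0 ≤ ν → ν < (d : ℝ) / 2 → ν ≤ k + 1 →
          NonnegCoeffs (fSeries ((d / 2 + ν : ℝ) : ℂ) ((d / 2 - ν : ℝ) : ℂ)) := by
        intro k
        induction k with
        | zero =>
          intro ν h0 h1 h2
          exact base ν h0 h1 (by norm_num at h2; linarith)
        | succ k ihk =>
          intro ν h0 h1 h2
          push_cast at h2
          rcases le_or_gt ν 1 with hν | hν
          · exact base ν h0 h1 (by linarith)
          have hk : (0 : ℝ) ≤ k := Nat.cast_nonneg k
          obtain ⟨e, rfl⟩ : ∃ e, d = e + 2 := ⟨d - 2, by omega⟩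
          push_cast at h1 hd3'
          have p1 := ih e (by omega) (by omega) (ν - 1) (by linarith) (by linarith)
          have p2 : NonnegCoeffs (fSeries ((((e + 2 : ℕ) : ℝ) / 2 + (ν - 2) : ℝ) : ℂ)
              ((((e + 2 : ℕ) : ℝ) / 2 - (ν - 2) : ℝ) : ℂ)) := by
            push_cast
            rcases le_or_gt 2 ν with hν2 | hν2
            · have := ihk (ν - 2) (by linarith) (by push_cast; linarith) (by linarith)
              push_cast at this
              exact this
            · have := ihk (2 - ν) (by linarith) (by push_cast; linarith) (by linarith)
              rw [fSeries_comm] at this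
              push_cast at this
              convert this using 2 <;> ring
          set a : ℝ := (e : ℝ) / 2 + (ν - 1) with ha
          set b : ℝ := (e : ℝ) / 2 - (ν - 1) with hb
          have hapos : 0 < a := by linarith
          have hbpos : 0 < b := by linarith
          have hab : (a : ℂ) + b = (e : ℂ) := by rw [ha, hb]; push_cast; ring
          have hcon := fSeries_contiguous hab
          have e1 : ((((e + 2 : ℕ) : ℝ) / 2 + ν : ℝ) : ℂ) = (a : ℂ) + 2 := by
            rw [ha]; push_cast; ring
          have e2 : ((((e + 2 : ℕ) : ℝ) / 2 - ν : ℝ) : ℂ) = (b : ℂ) := by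
            rw [hb]; push_cast; ring
          have e3 : ((((e + 2 : ℕ) : ℝ) / 2 + (ν - 2) : ℝ) : ℂ) = (a : ℂ) := by
            rw [ha]; push_cast; ring
          have e4 : ((((e + 2 : ℕ) : ℝ) / 2 - (ν - 2) : ℝ) : ℂ) = (b : ℂ) + 2 := by
            rw [hb]; push_cast; ring
          rw [e3, e4] at p2
          rw [e1, e2]
          have haa : (a : ℂ) * (a + 1) ≠ 0 := by
            have : a * (a + 1) ≠ 0 := by positivity
            exact_mod_cast this
          have hinv : fSeries ((a : ℂ) + 2) b = C ((a : ℂ) * (a + 1))⁻¹ *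
              (C (((a : ℂ) - b) * (e + 1)) * fSeries a b +
                C ((b : ℂ) * (b + 1)) * fSeries a (b + 2)) := by
            rw [← hcon, ← mul_assoc, ← map_mul, inv_mul_cancel₀ haa, map_one, one_mul]
          rw [hinv]
          refine NonnegCoeffs.C_mul ?_ (NonnegCoeffs.add (NonnegCoeffs.C_mul ?_ p1)
            (NonnegCoeffs.C_mul ?_ p2))
          · have : 0 ≤ (a * (a + 1))⁻¹ := by positivity
            exact_mod_cast this
          · have : 0 ≤ (a - b) * ((e : ℝ) + 1) := mul_nonneg (by linarith) (by positivity)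
            exact_mod_cast this
          · have : 0 ≤ b * (b + 1) := by positivity
            exact_mod_cast this
      obtain ⟨k, hk⟩ := exists_nat_ge ν
      exact step k ν h0 h1 (by linarith)

end DeSitter

namespace DeSitter

open PowerSeries Filter Topology

/-! ### Evaluation of power series -/

/-- Absolute convergence of the power series `p` at `ρ`. -/
def AbsConvAt (p : ℂ⟦X⟧) (ρ : ℂ) : Prop := Summable fun n => ‖coeff n p * ρ ^ n‖

/-- The value of the power series `p` at `ρ`. -/
noncomputable def evalAt (p : ℂ⟦X⟧) (ρ : ℂ) : ℂ := ∑' n, coeff n p * ρ ^ n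

/-- The sum of the norms of the terms of `p` at `ρ`. -/
noncomputable def absEvalAt (p : ℂ⟦X⟧) (ρ : ℂ) : ℝ := ∑' n, ‖coeff n p * ρ ^ n‖

theorem coeff_mul_mul_pow (p q : ℂ⟦X⟧) (ρ : ℂ) (n : ℕ) : coeff n (p * q) * ρ ^ n =
    ∑ kl ∈ Finset.HasAntidiagonal.antidiagonal n, (coeff kl.1 p * ρ ^ kl.1) * (coeff kl.2 q * ρ ^ kl.2) := by
  rw [coeff_mul, Finset.sum_mul]
  refine Finset.sum_congr rfl fun kl hkl => ?_
  rw [← Finset.HasAntidiagonal.mem_antidiagonal.1 hkl, pow_add]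
  ring

theorem AbsConvAt.mul {p q : ℂ⟦X⟧} {ρ : ℂ} (hp : AbsConvAt p ρ) (hq : AbsConvAt q ρ) :
    AbsConvAt (p * q) ρ := by
  have h := summable_norm_sum_mul_antidiagonal_of_summable_norm
    (f := fun n => coeff n p * ρ ^ n) (g := fun n => coeff n q * ρ ^ n) hp hq
  exact h.congr fun n => by rw [coeff_mul_mul_pow]

theorem evalAt_mul {p q : ℂ⟦X⟧} {ρ : ℂ} (hp : AbsConvAt p ρ) (hq : AbsConvAt q ρ) :
    evalAt (p * q) ρ = evalAt p ρ * evalAt q ρ := by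
  simp only [evalAt, coeff_mul_mul_pow]
  exact (tsum_mul_tsum_eq_tsum_sum_antidiagonal_of_summable_norm hp hq).symm

theorem absEvalAt_mul_le {p q : ℂ⟦X⟧} {ρ : ℂ} (hp : AbsConvAt p ρ) (hq : AbsConvAt q ρ) :
    absEvalAt (p * q) ρ ≤ absEvalAt p ρ * absEvalAt q ρ := by
  have hp' : Summable fun n => ‖‖coeff n p * ρ ^ n‖‖ := by simpa only [norm_norm, AbsConvAt] using hp
  have hq' : Summable fun n => ‖‖coeff n q * ρ ^ n‖‖ := by simpa only [norm_norm, AbsConvAt] using hq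
  rw [absEvalAt, absEvalAt, absEvalAt,
    tsum_mul_tsum_eq_tsum_sum_antidiagonal_of_summable_norm hp' hq']
  refine (hp.mul hq).tsum_le_tsum (fun n => ?_)
    ((summable_norm_sum_mul_antidiagonal_of_summable_norm hp' hq').of_norm)
  rw [coeff_mul_mul_pow]
  refine (norm_sum_le _ _).trans (Finset.sum_le_sum fun kl _ => ?_)
  rw [norm_mul]

theorem absEvalAt_nonneg (p : ℂ⟦X⟧) (ρ : ℂ) : 0 ≤ absEvalAt p ρ :=
  tsum_nonneg fun _ => norm_nonneg _

theorem hasSum_evalAt {p : ℂ⟦X⟧} {ρ : ℂ} (hp : AbsConvAt p ρ) :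
    HasSum (fun n => coeff n p * ρ ^ n) (evalAt p ρ) :=
  (Summable.of_norm hp).hasSum

theorem absConvAt_of_coeff_eq_zero {p : ℂ⟦X⟧} (N : ℕ) (h : ∀ n, N ≤ n → coeff n p = 0) (ρ : ℂ) :
    AbsConvAt p ρ :=
  summable_of_ne_finset_zero (s := Finset.range N) fun n hn => by
    rw [h n (by simpa using hn)]
    simp

theorem absConvAt_one (ρ : ℂ) : AbsConvAt 1 ρ :=
  absConvAt_of_coeff_eq_zero 1 (fun n hn => by rw [coeff_one, if_neg (by omega)]) ρ

theorem evalAt_one (ρ : ℂ) : evalAt 1 ρ = 1 := by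
  rw [evalAt, tsum_eq_single 0]
  · simp
  · intro n hn
    rw [coeff_one, if_neg hn, zero_mul]

theorem absEvalAt_one (ρ : ℂ) : absEvalAt 1 ρ = 1 := by
  rw [absEvalAt, tsum_eq_single 0]
  · simp
  · intro n hn
    rw [coeff_one, if_neg hn, zero_mul, norm_zero]

theorem AbsConvAt.pow {p : ℂ⟦X⟧} {ρ : ℂ} (hp : AbsConvAt p ρ) (k : ℕ) : AbsConvAt (p ^ k) ρ := by
  induction k with
  | zero => rw [pow_zero]; exact absConvAt_one ρ
  | succ k ih => rw [pow_succ]; exact ih.mul hp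

theorem evalAt_pow {p : ℂ⟦X⟧} {ρ : ℂ} (hp : AbsConvAt p ρ) (k : ℕ) :
    evalAt (p ^ k) ρ = evalAt p ρ ^ k := by
  induction k with
  | zero => rw [pow_zero, pow_zero, evalAt_one]
  | succ k ih => rw [pow_succ, evalAt_mul (hp.pow k) hp, ih, pow_succ]

theorem absEvalAt_pow_le {p : ℂ⟦X⟧} {ρ : ℂ} (hp : AbsConvAt p ρ) (k : ℕ) :
    absEvalAt (p ^ k) ρ ≤ absEvalAt p ρ ^ k := by
  induction k with
  | zero => rw [pow_zero, pow_zero, absEvalAt_one]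
  | succ k ih =>
    rw [pow_succ, pow_succ]
    exact (absEvalAt_mul_le (hp.pow k) hp).trans
      (mul_le_mul_of_nonneg_right ih (absEvalAt_nonneg p ρ))

theorem coeff_four_mul_X (n : ℕ) : coeff n (4 * X : ℂ⟦X⟧) = if n = 1 then 4 else 0 := by
  rw [← map_ofNat C 4, coeff_C_mul, coeff_X]
  split_ifs <;> simp

theorem absConvAt_four_mul_X (ρ : ℂ) : AbsConvAt (4 * X) ρ :=
  absConvAt_of_coeff_eq_zero 2 (fun n hn => by rw [coeff_four_mul_X, if_neg (by omega)]) ρ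

theorem evalAt_four_mul_X (ρ : ℂ) : evalAt (4 * X) ρ = 4 * ρ := by
  rw [evalAt, tsum_eq_single 1]
  · rw [coeff_four_mul_X]; simp
  · intro n hn
    rw [coeff_four_mul_X, if_neg hn, zero_mul]

theorem absEvalAt_four_mul_X (ρ : ℂ) : absEvalAt (4 * X) ρ = 4 * ‖ρ‖ := by
  rw [absEvalAt, tsum_eq_single 1]
  · rw [coeff_four_mul_X]; simp
  · intro n hn
    rw [coeff_four_mul_X, if_neg hn, zero_mul, norm_zero]

theorem absConvAt_one_add_X (ρ : ℂ) : AbsConvAt (1 + X) ρ :=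
  absConvAt_of_coeff_eq_zero 2
    (fun n hn => by rw [map_add, coeff_one, coeff_X, if_neg (by omega), if_neg (by omega), add_zero]) ρ

theorem evalAt_one_add_X (ρ : ℂ) : evalAt (1 + X) ρ = 1 + ρ := by
  rw [evalAt, tsum_eq_sum (s := Finset.range 2)]
  · simp [Finset.sum_range_succ, coeff_one, coeff_X]
  · intro n hn
    have : 2 ≤ n := by simpa [Nat.lt_iff_add_one_le] using hn
    rw [map_add, coeff_one, coeff_X, if_neg (by omega), if_neg (by omega), add_zero, zero_mul]

theorem coeff_inv_one_add_X (n : ℕ) : coeff n ((1 + X : ℂ⟦X⟧)⁻¹) = (-1) ^ n := by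
  have h : (1 + X : ℂ⟦X⟧) * PowerSeries.mk (fun n => (-1 : ℂ) ^ n) = 1 := by
    ext n
    rcases n with _ | n
    · simp [add_mul]
    · rw [add_mul, one_mul, map_add, coeff_succ_X_mul, coeff_mk, coeff_mk, coeff_one,
        if_neg n.succ_ne_zero, pow_succ]
      ring
  have : (1 + X : ℂ⟦X⟧)⁻¹ = PowerSeries.mk (fun n => (-1 : ℂ) ^ n) :=
    mul_left_cancel₀ one_add_X_ne_zero (one_add_X_mul_inv.trans h.symm)
  rw [this, coeff_mk]

theorem absConvAt_inv_one_add_X {ρ : ℂ} (h : ‖ρ‖ < 1) : AbsConvAt (1 + X)⁻¹ ρ := by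
  simp only [AbsConvAt, coeff_inv_one_add_X, norm_mul, norm_pow, norm_neg, norm_one, one_pow,
    one_mul]
  exact summable_geometric_of_lt_one (norm_nonneg _) h

theorem absEvalAt_inv_one_add_X {ρ : ℂ} (h : ‖ρ‖ < 1) :
    absEvalAt (1 + X)⁻¹ ρ = (1 - ‖ρ‖)⁻¹ := by
  simp only [absEvalAt, coeff_inv_one_add_X, norm_mul, norm_pow, norm_neg, norm_one, one_pow,
    one_mul]
  exact tsum_geometric_of_lt_one (norm_nonneg _) h

theorem absConvAt_radialZ {ρ : ℂ} (h : ‖ρ‖ < 1) : AbsConvAt radialZ ρ :=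
  (absConvAt_four_mul_X ρ).mul ((absConvAt_inv_one_add_X h).pow 2)

theorem one_add_ne_zero_of_norm_lt_one {ρ : ℂ} (h : ‖ρ‖ < 1) : 1 + ρ ≠ 0 := by
  intro h0
  have : ρ = -1 := by linear_combination h0
  rw [this, norm_neg, norm_one] at h
  exact lt_irrefl _ h

theorem evalAt_radialZ {ρ : ℂ} (h : ‖ρ‖ < 1) : evalAt radialZ ρ = 4 * ρ / (1 + ρ) ^ 2 := by
  rw [eq_div_iff (pow_ne_zero 2 (one_add_ne_zero_of_norm_lt_one h)), ← evalAt_one_add_X,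
    ← evalAt_pow (absConvAt_one_add_X ρ),
    ← evalAt_mul (absConvAt_radialZ h) ((absConvAt_one_add_X ρ).pow 2), radialZ_mul,
    evalAt_four_mul_X]

theorem absEvalAt_radialZ_le {ρ : ℂ} (h : ‖ρ‖ ≤ 1 / 16) : absEvalAt radialZ ρ ≤ 1 / 2 := by
  have h1 : ‖ρ‖ < 1 := by linarith
  have hinv := absConvAt_inv_one_add_X h1
  have e1 := absEvalAt_mul_le (absConvAt_four_mul_X ρ) (hinv.pow 2)
  have e2 := absEvalAt_pow_le hinv 2
  rw [absEvalAt_four_mul_X] at e1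
  rw [absEvalAt_inv_one_add_X h1] at e2
  have e3 : (1 - ‖ρ‖)⁻¹ ≤ 16 / 15 := by
    rw [inv_le_comm₀ (by linarith) (by norm_num)]
    norm_num
    linarith
  have e4 : (1 - ‖ρ‖)⁻¹ ^ 2 ≤ (16 / 15) ^ 2 :=
    pow_le_pow_left₀ (inv_nonneg.2 (by linarith)) e3 2
  have e5 : absEvalAt ((1 + X)⁻¹ ^ 2) ρ ≤ (16 / 15) ^ 2 := e2.trans e4
  have e6 : 4 * ‖ρ‖ * absEvalAt ((1 + X)⁻¹ ^ 2) ρ ≤ (1 / 4) * (16 / 15) ^ 2 :=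
    mul_le_mul (by linarith) e5 (absEvalAt_nonneg _ _) (by norm_num)
  rw [radialZ]
  linarith

/-- Evaluation of the substituted series near the origin. -/
theorem evalAt_fSeries {a b ρ : ℂ} (h : ‖ρ‖ ≤ 1 / 16)
    (hu : Summable fun k => ‖gaussCoeff a b k‖ * (1 / 2 : ℝ) ^ k) :
    evalAt (fSeries a b) ρ = ∑' k, gaussCoeff a b k * (4 * ρ / (1 + ρ) ^ 2) ^ k := by
  have h1 : ‖ρ‖ < 1 := by linarith
  have hZ := absConvAt_radialZ h1
  set F : ℕ × ℕ → ℂ := fun x => gaussCoeff a b x.1 * (coeff x.2 (radialZ ^ x.1) * ρ ^ x.2) with hF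
  have hsum : Summable F := by
    refine Summable.of_norm ?_
    rw [summable_prod_of_nonneg (fun _ => norm_nonneg _)]
    refine ⟨fun k => ?_, ?_⟩
    · simp only [hF, norm_mul (gaussCoeff a b k)]
      exact (hZ.pow k).mul_left _
    · refine hu.of_nonneg_of_le (fun k => tsum_nonneg fun _ => norm_nonneg _) fun k => ?_
      simp only [hF, norm_mul (gaussCoeff a b k)]
      rw [tsum_mul_left]
      refine mul_le_mul_of_nonneg_left ?_ (norm_nonneg _)
      -- The majorant of `4X/(1+X)²` is at most `1/2` here, so the double series is dominated by the
      -- Gauss series at `1/2`; this permits the exchange of summations.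
      exact (absEvalAt_pow_le hZ k).trans
        (pow_le_pow_left₀ (absEvalAt_nonneg _ _) (absEvalAt_radialZ_le h) k)
  have hcoeff : ∀ n, coeff n (fSeries a b) * ρ ^ n = ∑' k, F (k, n) := by
    intro n
    rw [fSeries, coeff_subst' hasSubst_radialZ, ← tsum_eq_finsum (L := .unconditional ℕ)
      (coeff_subst_finite' hasSubst_radialZ _ n), ← tsum_mul_right]
    refine tsum_congr fun k => ?_
    simp only [hF, coeff_mk, smul_eq_mul]
    ring
  rw [evalAt]
  simp only [hcoeff]
  rw [Summable.tsum_comm (f := fun k n => F (k, n)) hsum]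
  refine tsum_congr fun k => ?_
  simp only [hF]
  rw [tsum_mul_left]
  congr 1
  rw [← evalAt_radialZ h1, ← evalAt_pow hZ]
  rfl

/-! ### Convergence on the unit disc -/

theorem absConvAt_binomSeries (α : ℂ) {ρ : ℂ} (h : ‖ρ‖ < 1) : AbsConvAt (binomSeries α) ρ := by
  -- Ratio test: this bounds the ratio of consecutive terms.
  have hlim : Tendsto (fun n : ℕ => (‖α‖ + n) / ((n : ℝ) + 1) * ‖ρ‖) atTop (𝓝 (1 * ‖ρ‖)) := by
    refine Tendsto.mul_const _ ?_
    have h1 : Tendsto (fun n : ℕ => (‖α‖ - 1) * (1 / ((n : ℝ) + 1)) + 1) atTop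
        (𝓝 ((‖α‖ - 1) * 0 + 1)) :=
      (tendsto_one_div_add_atTop_nhds_zero_nat.const_mul _).add_const _
    rw [mul_zero, zero_add] at h1
    refine h1.congr fun n => ?_
    have : (n : ℝ) + 1 ≠ 0 := by positivity
    field_simp
    ring
  rw [one_mul] at hlim
  obtain ⟨r, hr1, hr2⟩ := exists_between h
  have hev := hlim.eventually (gt_mem_nhds hr1)
  refine summable_of_ratio_norm_eventually_le hr2 (hev.mono fun n hn => ?_)
  rw [norm_norm, norm_norm]
  have hrec := succ_mul_binom_coeff α n
  simp only [binomSeries, coeff_mk]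
  set u := poch α (n + 1) / ((n + 1).factorial : ℂ)
  set v := poch α n / (n.factorial : ℂ)
  have hn0 : (0 : ℝ) < (n : ℝ) + 1 := by positivity
  have hnorm : ((n : ℝ) + 1) * ‖u‖ ≤ (‖α‖ + n) * ‖v‖ := by
    have := congrArg norm hrec
    rw [norm_mul, norm_mul] at this
    have hn1 : ‖(n : ℂ) + 1‖ = (n : ℝ) + 1 := by
      rw [← Nat.cast_succ, Complex.norm_natCast, Nat.cast_succ]
    rw [hn1] at this
    rw [this]
    refine mul_le_mul_of_nonneg_right ((norm_add_le _ _).trans ?_) (norm_nonneg _)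
    rw [Complex.norm_natCast]
  have hu : ‖u‖ ≤ (‖α‖ + n) / ((n : ℝ) + 1) * ‖v‖ := by
    rw [div_mul_eq_mul_div, le_div_iff₀ hn0]
    linarith
  calc ‖u * ρ ^ (n + 1)‖ = ‖u‖ * ‖ρ‖ * ‖ρ‖ ^ n := by rw [norm_mul, norm_pow, pow_succ]; ring
    _ ≤ (‖α‖ + n) / ((n : ℝ) + 1) * ‖v‖ * ‖ρ‖ * ‖ρ‖ ^ n := by gcongr
    _ = (‖α‖ + n) / ((n : ℝ) + 1) * ‖ρ‖ * ‖v * ρ ^ n‖ := by rw [norm_mul, norm_pow]; ring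
    _ ≤ r * ‖v * ρ ^ n‖ := mul_le_mul_of_nonneg_right hn.le (norm_nonneg _)

theorem absConvAt_altBinomSeries (α : ℂ) {ρ : ℂ} (h : ‖ρ‖ < 1) :
    AbsConvAt (altBinomSeries α) ρ := by
  refine (absConvAt_binomSeries α h).congr fun n => ?_
  simp only [binomSeries, altBinomSeries, coeff_mk, norm_mul, norm_div, norm_pow, norm_neg,
    norm_one, one_pow, one_mul]

theorem absConvAt_aSeries (p q : ℂ) {ρ : ℂ} (h : ‖ρ‖ < 1) : AbsConvAt (aSeries p q) ρ :=
  (absConvAt_altBinomSeries q h).mul (absConvAt_binomSeries p h)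

theorem norm_weight_le_one {d : ℕ} (hd : 1 ≤ d) (m : ℕ) :
    ‖(m.factorial : ℂ) / poch (((d : ℂ) + 1) / 2) m‖ ≤ 1 := by
  induction m with
  | zero => simp [poch_zero]
  | succ m ih =>
    have h := congrArg norm (weight_succ (half_succ_add_ne_zero d) m)
    rw [norm_mul, norm_mul] at h
    have h1 : ‖((d : ℂ) + 1) / 2 + m‖ = ((d : ℝ) + 1) / 2 + m := by
      have : ((d : ℂ) + 1) / 2 + m = ((((d : ℝ) + 1) / 2 + m : ℝ) : ℂ) := by push_cast; ring
      rw [this, Complex.norm_real, Real.norm_of_nonneg (by positivity)]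
    have h2 : ‖(m : ℂ) + 1‖ = (m : ℝ) + 1 := by
      rw [← Nat.cast_succ, Complex.norm_natCast, Nat.cast_succ]
    rw [h1, h2] at h
    have hd' : (1 : ℝ) ≤ d := by exact_mod_cast hd
    have hm : (0 : ℝ) ≤ m := Nat.cast_nonneg m
    by_contra hlt
    push Not at hlt
    nlinarith

/-- A Hadamard product: with `s² = |ρ|`, the terms are bounded by the diagonal of the product of two
series converging absolutely at `s < 1`. The weights `m!/(c)ₘ` are at most 1 because `c ≥ 1`. -/
theorem absConvAt_bilinSeries {d : ℕ} (hd : 1 ≤ d) (a b : ℂ) {ρ : ℂ} (h : ‖ρ‖ < 1) :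
    AbsConvAt (bilinSeries a b (((d : ℂ) + 1) / 2)) ρ := by
  set s : ℝ := Real.sqrt ‖ρ‖ with hs
  have hs0 : 0 ≤ s := Real.sqrt_nonneg _
  have hss : s * s = ‖ρ‖ := Real.mul_self_sqrt (norm_nonneg _)
  have hs1 : ‖(s : ℂ)‖ < 1 := by
    rw [Complex.norm_real, Real.norm_of_nonneg hs0]
    nlinarith
  have hA := absConvAt_aSeries (((d : ℂ) + 1) / 2 - a) a hs1
  have hB := absConvAt_aSeries (((d : ℂ) + 1) / 2 - b) b hs1
  refine Summable.of_nonneg_of_le (fun _ => norm_nonneg _) (fun n => ?_)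
    ((summable_mul_of_summable_norm hA hB).norm.comp_injective
      (i := fun n : ℕ => (n, n)) fun m n h => (Prod.ext_iff.1 h).1)
  rw [coeff_bilinSeries]
  simp only [Function.comp, norm_mul, norm_pow, Complex.norm_real, Real.norm_of_nonneg hs0]
  rw [← hss, mul_pow]
  have := norm_weight_le_one hd n
  have hx := norm_nonneg (coeff n (aSeries (((d : ℂ) + 1) / 2 - a) a))
  have hy := norm_nonneg (coeff n (aSeries (((d : ℂ) + 1) / 2 - b) b))
  generalize ‖(n.factorial : ℂ) / poch (((d : ℂ) + 1) / 2) n‖ = w at *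
  generalize ‖coeff n (aSeries (((d : ℂ) + 1) / 2 - a) a)‖ = x at *
  generalize ‖coeff n (aSeries (((d : ℂ) + 1) / 2 - b) b)‖ = y at *
  calc w * (x * y) * (s ^ n * s ^ n) = w * (x * y * (s ^ n * s ^ n)) := by ring
    _ ≤ 1 * (x * y * (s ^ n * s ^ n)) := mul_le_mul_of_nonneg_right this (by positivity)
    _ = x * s ^ n * (y * s ^ n) := by ring

theorem absConvAt_bSeries {d : ℕ} (hd : 1 ≤ d) (a b : ℂ) {ρ : ℂ} (h : ‖ρ‖ < 1) :
    AbsConvAt (bSeries d a b) ρ :=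
  ((absConvAt_one_add_X ρ).pow d).mul
    ((absConvAt_binomSeries _ h).mul (absConvAt_bilinSeries hd a b h))

theorem analyticOnNhd_evalAt {p : ℂ⟦X⟧} (hp : ∀ ρ : ℂ, ‖ρ‖ < 1 → AbsConvAt p ρ) :
    AnalyticOnNhd ℂ (evalAt p) (Metric.ball 0 1) := by
  set q := FormalMultilinearSeries.ofScalars ℂ (fun n => coeff n p) with hq
  have hrad : 1 ≤ q.radius := by
    refine ENNReal.le_of_forall_nnreal_lt fun r hr => ?_
    refine q.le_radius_of_summable ?_
    have hr' : ‖((r : ℝ) : ℂ)‖ < 1 := by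
      rw [Complex.norm_real, Real.norm_of_nonneg r.coe_nonneg]
      exact_mod_cast hr
    refine (hp _ hr').congr fun n => ?_
    rw [hq, FormalMultilinearSeries.ofScalars_norm, norm_mul, norm_pow, Complex.norm_real,
      Real.norm_of_nonneg r.coe_nonneg]
  have heq : q.sum = evalAt p := by
    funext z
    exact FormalMultilinearSeries.ofScalars_sum_eq _ z
  have h := (q.hasFPowerSeriesOnBall (zero_lt_one.trans_le hrad)).mono zero_lt_one hrad
  rw [heq] at h
  have h' := h.analyticOnNhd
  rwa [← ENNReal.ofReal_one, Metric.eball_ofReal] at h'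

end DeSitter

namespace DeSitter

open PowerSeries Filter Topology

/-! ### The radial variable -/

/-- The radial variable `ρ = (1 - √(1-z)) / (1 + √(1-z))` as a function of `z`. -/
noncomputable def radialOf (z : ℂ) : ℂ :=
  (1 - (1 - z) ^ (1 / 2 : ℂ)) / (1 + (1 - z) ^ (1 / 2 : ℂ))

theorem radial_eq_radialOf (σ : ℂ) : radial σ = radialOf ((1 + σ) / 2) := rfl

theorem cpow_half_sq (w : ℂ) : (w ^ (1 / 2 : ℂ)) ^ 2 = w := by
  have := Complex.cpow_nat_inv_pow w (n := 2) two_ne_zero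
  rwa [Nat.cast_ofNat, ← one_div] at this

theorem cpow_half_re_pos {w : ℂ} (hw : w ∈ Complex.slitPlane) : 0 < (w ^ (1 / 2 : ℂ)).re := by
  have hw0 : w ≠ 0 := Complex.slitPlane_ne_zero hw
  have harg := Complex.mem_slitPlane_iff_arg.1 hw
  rw [Complex.cpow_def_of_ne_zero hw0, Complex.exp_re]
  refine mul_pos (Real.exp_pos _) (Real.cos_pos_of_mem_Ioo ?_)
  have him : (Complex.log w * (1 / 2)).im = w.arg / 2 := by
    rw [show (1 / 2 : ℂ) = ((1 / 2 : ℝ) : ℂ) by push_cast; rfl, Complex.im_mul_ofReal,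
      Complex.log_im]
    ring
  rw [him]
  have h1 := Complex.neg_pi_lt_arg w
  have h2 := lt_of_le_of_ne (Complex.arg_le_pi w) harg.1
  constructor <;> linarith

theorem cpow_half_of_sq {u : ℂ} (hu : 0 < u.re) : (u ^ 2) ^ (1 / 2 : ℂ) = u := by
  rw [one_div]
  exact Complex.sq_cpow_two_inv hu

theorem norm_one_sub_div_one_add_lt {u : ℂ} (hu : 0 < u.re) : ‖(1 - u) / (1 + u)‖ < 1 := by
  have hne : 1 + u ≠ 0 := by
    intro h
    have := congrArg Complex.re h
    simp at this
    linarith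
  rw [norm_div, div_lt_one (norm_pos_iff.2 hne)]
  refine lt_of_pow_lt_pow_left₀ 2 (norm_nonneg _) ?_
  rw [← Complex.normSq_eq_norm_sq, ← Complex.normSq_eq_norm_sq, Complex.normSq_apply,
    Complex.normSq_apply]
  simp
  nlinarith

theorem one_sub_div_one_add_re_pos {ρ : ℂ} (h : ‖ρ‖ < 1) : 0 < ((1 - ρ) / (1 + ρ)).re := by
  have hne := one_add_ne_zero_of_norm_lt_one h
  have hsq : ρ.re * ρ.re + ρ.im * ρ.im < 1 := by
    rw [← Complex.normSq_apply, Complex.normSq_eq_norm_sq]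
    nlinarith [norm_nonneg ρ]
  have hpos := Complex.normSq_pos.2 hne
  rw [Complex.div_re, ← add_div]
  refine div_pos ?_ hpos
  simp
  nlinarith

theorem norm_radialOf_lt_one {z : ℂ} (hz : z ∈ cutPlane) : ‖radialOf z‖ < 1 :=
  norm_one_sub_div_one_add_lt (cpow_half_re_pos hz)

theorem four_mul_radialOf {z : ℂ} (hz : z ∈ cutPlane) :
    4 * radialOf z / (1 + radialOf z) ^ 2 = z := by
  have hpos := cpow_half_re_pos hz
  have hsq := cpow_half_sq (1 - z)
  rw [radialOf]
  set w := (1 - z) ^ (1 / 2 : ℂ)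
  have hne : 1 + w ≠ 0 := by
    intro h
    have := congrArg Complex.re h
    simp at this
    linarith
  have h2 : 1 + (1 - w) / (1 + w) = 2 / (1 + w) := by
    field_simp
    ring
  rw [h2]
  field_simp
  linear_combination -4 * hsq

theorem one_sub_four_mul {ρ : ℂ} (h : ‖ρ‖ < 1) :
    1 - 4 * ρ / (1 + ρ) ^ 2 = ((1 - ρ) / (1 + ρ)) ^ 2 := by
  have hne := one_add_ne_zero_of_norm_lt_one h
  field_simp
  ring

theorem radialOf_four_mul {ρ : ℂ} (h : ‖ρ‖ < 1) : radialOf (4 * ρ / (1 + ρ) ^ 2) = ρ := by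
  have hne := one_add_ne_zero_of_norm_lt_one h
  rw [radialOf, one_sub_four_mul h, cpow_half_of_sq (one_sub_div_one_add_re_pos h)]
  have h2 : 1 + (1 - ρ) / (1 + ρ) = 2 / (1 + ρ) := by
    field_simp
    ring
  rw [h2]
  field_simp
  ring

theorem four_mul_mem_cutPlane {ρ : ℂ} (h : ‖ρ‖ < 1) : 4 * ρ / (1 + ρ) ^ 2 ∈ cutPlane := by
  have hu := one_sub_div_one_add_re_pos h
  rw [cutPlane, Set.mem_ofPred_eq, one_sub_four_mul h]
  set u := (1 - ρ) / (1 + ρ)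
  rw [Complex.mem_slitPlane_iff]
  by_cases him : u.im = 0
  · left
    rw [sq, Complex.mul_re, him]
    nlinarith
  · right
    rw [sq, Complex.mul_im]
    have : u.re * u.im + u.im * u.re = 2 * (u.re * u.im) := by ring
    rw [this]
    exact mul_ne_zero two_ne_zero (mul_ne_zero hu.ne' him)

theorem analyticOnNhd_radialOf : AnalyticOnNhd ℂ radialOf cutPlane := by
  intro z hz
  have h1 : AnalyticAt ℂ (fun z : ℂ => (1 - z) ^ (1 / 2 : ℂ)) z :=
    (analyticAt_const.sub analyticAt_id).cpow analyticAt_const hz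
  refine (analyticAt_const.sub h1).div (analyticAt_const.add h1) ?_
  intro h
  have := congrArg Complex.re h
  have hpos := cpow_half_re_pos hz
  simp only [Complex.add_re, Complex.one_re, Complex.zero_re] at this
  linarith

theorem zero_mem_cutPlane : (0 : ℂ) ∈ cutPlane := by simp [cutPlane]

theorem radialOf_zero : radialOf 0 = 0 := by simp [radialOf]

theorem ball_subset_cutPlane : Metric.ball (0 : ℂ) 1 ⊆ cutPlane := by
  intro z hz
  have hz' : ‖z‖ < 1 := by simpa using hz
  rw [cutPlane, Set.mem_ofPred_eq, Complex.mem_slitPlane_iff]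
  left
  have := Complex.re_le_norm z
  simp only [Complex.sub_re, Complex.one_re]
  linarith

/-! ### The hypergeometric function on the cut plane -/

theorem Gamma_half_succ_ne_zero (d : ℕ) : Complex.Gamma (((d : ℂ) + 1) / 2) ≠ 0 := by
  refine Complex.Gamma_ne_zero fun m h => half_succ_add_ne_zero d m ?_
  rw [h]
  ring

theorem coeff_gaussSeries_eq {d : ℕ} {a b : ℂ} (hab : a + b = d) (n : ℕ) :
    (Complex.regularizedGaussHGFunSeries a b (((d : ℂ) + 1) / 2)).coeff n =
      gaussCoeff a b n / Complex.Gamma (((d : ℂ) + 1) / 2) := by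
  have hG := Complex.Gamma_add_nat_div_Gamma_eq (n := n) (((d : ℂ) + 1) / 2)
    (fun m h => half_succ_add_ne_zero d m (by rw [h]; ring))
  have h0 := Gamma_half_succ_ne_zero d
  rw [div_eq_iff h0] at hG
  rw [Complex.coeff_regularizedGaussHGFunSeries, gaussCoeff, hab, hG]
  simp only [poch]
  rw [div_div]
  congr 1
  ring

theorem summable_norm_gaussCoeff {d : ℕ} {a b : ℂ} (hab : a + b = d) {z : ℂ} (hz : ‖z‖ < 1) :
    Summable fun k => ‖gaussCoeff a b k * z ^ k‖ := by
  have hrad := Complex.radius_regularizedGaussHGFunSeries_ge_one a b (((d : ℂ) + 1) / 2)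
  have hmem : z ∈ Metric.eball (0 : ℂ)
      (Complex.regularizedGaussHGFunSeries a b (((d : ℂ) + 1) / 2)).radius := by
    refine Metric.eball_subset_eball hrad ?_
    rw [← ENNReal.ofReal_one, Metric.eball_ofReal]
    simpa using hz
  have h := (Complex.regularizedGaussHGFunSeries a b (((d : ℂ) + 1) / 2)).summable_norm_apply hmem
  have h' := h.mul_left ‖Complex.Gamma (((d : ℂ) + 1) / 2)‖
  refine h'.congr fun n => ?_
  have h0 := Gamma_half_succ_ne_zero d
  rw [FormalMultilinearSeries.apply_eq_pow_smul_coeff, coeff_gaussSeries_eq hab, ← norm_mul,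
    smul_eq_mul]
  congr 1
  field_simp

theorem regularizedGaussHGFun_eq {d : ℕ} {a b : ℂ} (hab : a + b = d) (z : ℂ) :
    Complex.regularizedGaussHGFun a b (((d : ℂ) + 1) / 2) z =
      (∑' k, gaussCoeff a b k * z ^ k) / Complex.Gamma (((d : ℂ) + 1) / 2) := by
  rw [Complex.regularizedGaussHGFun, FormalMultilinearSeries.sum, ← tsum_div_const]
  refine tsum_congr fun k => ?_
  rw [FormalMultilinearSeries.apply_eq_pow_smul_coeff, coeff_gaussSeries_eq hab, smul_eq_mul]
  ring

/-- Supplies the existence of the continuation, so the fallback branch of `hypergeometricF` never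
occurs here. The `ρ`-series is analytic on the cut plane, agrees with the Gauss series where `|ρ| ≤
1/16`, hence on the unit disc of `z` by the identity theorem. -/
theorem isHypergeometricContinuation_radial {d : ℕ} (hd : 1 ≤ d) {a b : ℂ} (hab : a + b = d) :
    IsHypergeometricContinuation a b (((d : ℂ) + 1) / 2) fun z =>
      evalAt (bSeries d a b) (radialOf z) / Complex.Gamma (((d : ℂ) + 1) / 2) := by
  have hconv : ∀ ρ : ℂ, ‖ρ‖ < 1 → AbsConvAt (bSeries d a b) ρ := fun ρ h =>
    absConvAt_bSeries hd a b h
  have han : AnalyticOnNhd ℂ (fun z => evalAt (bSeries d a b) (radialOf z) /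
      Complex.Gamma (((d : ℂ) + 1) / 2)) cutPlane := by
    intro z hz
    refine AnalyticAt.div ?_ analyticAt_const (Gamma_half_succ_ne_zero d)
    exact AnalyticAt.fun_comp (analyticOnNhd_evalAt hconv (radialOf z)
      (by simpa using norm_radialOf_lt_one hz)) (analyticOnNhd_radialOf z hz)
  refine ⟨han, ?_⟩
  have hrad := Complex.radius_regularizedGaussHGFunSeries_ge_one a b (((d : ℂ) + 1) / 2)
  have hgauss : AnalyticOnNhd ℂ (Complex.regularizedGaussHGFun a b (((d : ℂ) + 1) / 2))
      (Metric.ball 0 1) := by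
    have h := ((Complex.regularizedGaussHGFunSeries a b (((d : ℂ) + 1) / 2)).hasFPowerSeriesOnBall
      (zero_lt_one.trans_le hrad)).mono zero_lt_one hrad
    have h' := h.analyticOnNhd
    rwa [← ENNReal.ofReal_one, Metric.eball_ofReal] at h'
  have heq := (han.mono ball_subset_cutPlane).eqOn_of_preconnected_of_eventuallyEq hgauss
    (convex_ball (0 : ℂ) 1).isPreconnected (Metric.mem_ball_self one_pos) (by
      have hcont : Tendsto (fun z => ‖radialOf z‖) (𝓝 0) (𝓝 0) := by
        have := (analyticOnNhd_radialOf 0 zero_mem_cutPlane).continuousAt.norm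
        simpa [ContinuousAt, radialOf_zero] using this
      filter_upwards [hcont.eventually (ge_mem_nhds (by norm_num : (0 : ℝ) < 1 / 16)),
        Metric.ball_mem_nhds (0 : ℂ) one_pos] with z hz hz1
      rw [regularizedGaussHGFun_eq hab, bSeries_eq_fSeries hab, evalAt_fSeries hz,
        four_mul_radialOf (ball_subset_cutPlane hz1)]
      refine (summable_norm_gaussCoeff hab (z := 1 / 2) (by norm_num)).congr fun k => ?_
      rw [norm_mul, norm_pow]
      norm_num)
  intro z hz
  exact heq (by simpa using hz)

theorem hypergeometricF_eq {d : ℕ} (hd : 1 ≤ d) {a b : ℂ} (hab : a + b = d) {z : ℂ}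
    (hz : z ∈ cutPlane) : hypergeometricF a b (((d : ℂ) + 1) / 2) z =
      evalAt (bSeries d a b) (radialOf z) / Complex.Gamma (((d : ℂ) + 1) / 2) :=
  hypergeometricF_eqOn (isHypergeometricContinuation_radial hd hab) hz

/-! ### The free propagator -/

theorem bCoeff_eq (d n : ℕ) (lam : ℂ) : bCoeff d n lam =
    coeff n (bSeries d ((d : ℂ) / 2 + Complex.I * lam) ((d : ℂ) / 2 - Complex.I * lam)) := by
  have hchoose : ∀ l, coeff l ((1 + X : ℂ⟦X⟧) ^ d) = (d.choose l : ℂ) := by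
    intro l
    have : ((1 + X : ℂ⟦X⟧) ^ d) = (((1 + Polynomial.X) ^ d : Polynomial ℂ) : ℂ⟦X⟧) := by
      simp
    rw [this, Polynomial.coeff_coe, Polynomial.coeff_one_add_X_pow]
  have hinner : ∀ m, coeff m (binomSeries (((d : ℂ) - 1) / 2) *
      bilinSeries ((d : ℂ) / 2 + Complex.I * lam) ((d : ℂ) / 2 - Complex.I * lam)
        (((d : ℂ) + 1) / 2)) = ∑ k ∈ Finset.range (m + 1),
      (poch (((d : ℂ) - 1) / 2) k * ((m - k).factorial : ℂ) /
        ((k.factorial : ℂ) * poch (((d : ℂ) + 1) / 2) (m - k))) *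
      (aCoeff (m - k) (((d : ℂ) + 1) / 4) (-(((d : ℂ) - 1) / 4) + Complex.I * lam) *
        aCoeff (m - k) (((d : ℂ) + 1) / 4) (-(((d : ℂ) - 1) / 4) - Complex.I * lam)) := by
    intro m
    rw [coeff_mul, Finset.Nat.sum_antidiagonal_eq_sum_range_succ_mk]
    refine Finset.sum_congr rfl fun k _ => ?_
    rw [aCoeff_eq, aCoeff_eq, coeff_bilinSeries]
    simp only [binomSeries, coeff_mk]
    have e1 : ((d : ℂ) + 1) / 4 + (-(((d : ℂ) - 1) / 4) + Complex.I * lam) =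
        ((d : ℂ) + 1) / 2 - ((d : ℂ) / 2 - Complex.I * lam) := by ring
    have e2 : ((d : ℂ) + 1) / 4 - (-(((d : ℂ) - 1) / 4) + Complex.I * lam) =
        (d : ℂ) / 2 - Complex.I * lam := by ring
    have e3 : ((d : ℂ) + 1) / 4 + (-(((d : ℂ) - 1) / 4) - Complex.I * lam) =
        ((d : ℂ) + 1) / 2 - ((d : ℂ) / 2 + Complex.I * lam) := by ring
    have e4 : ((d : ℂ) + 1) / 4 - (-(((d : ℂ) - 1) / 4) - Complex.I * lam) =
        (d : ℂ) / 2 + Complex.I * lam := by ring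
    rw [e1, e2, e3, e4, mul_comm (coeff (m - k) (aSeries _ ((d : ℂ) / 2 - Complex.I * lam))),
      mul_div_mul_comm, mul_assoc]
  rw [bSeries, coeff_mul, Finset.Nat.sum_antidiagonal_eq_sum_range_succ_mk, bCoeff]
  simp only [hchoose, hinner, Finset.mul_sum]
  set f : ℕ → ℂ := fun l => ∑ k ∈ Finset.range (n + 1 - l), (d.choose l : ℂ) *
      (poch (((d : ℂ) - 1) / 2) k * ((n - l - k).factorial : ℂ) /
        ((k.factorial : ℂ) * poch (((d : ℂ) + 1) / 2) (n - l - k))) *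
      (aCoeff (n - l - k) (((d : ℂ) + 1) / 4) (-(((d : ℂ) - 1) / 4) + Complex.I * lam) *
        aCoeff (n - l - k) (((d : ℂ) + 1) / 4) (-(((d : ℂ) - 1) / 4) - Complex.I * lam)) with hf
  have h1 : ∀ l, d < l → f l = 0 := by
    intro l hl
    simp [hf, Nat.choose_eq_zero_of_lt hl]
  have h2 : ∀ l, n < l → f l = 0 := by
    intro l hl
    simp [hf, Nat.sub_eq_zero_of_le (Nat.succ_le_of_lt hl)]
  -- The definition sums over `l ≤ d`, the Cauchy product over `l ≤ n`. Both equal the sum up to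
  -- `max d n`, the extra terms vanishing by the binomial coefficient or by an empty inner sum.
  have h3 : ∀ M, d ≤ M → n ≤ M → ∑ l ∈ Finset.range (d + 1), f l =
      ∑ l ∈ Finset.range (M + 1), f l := fun M hM _ =>
    Finset.sum_subset (Finset.range_mono (by omega)) fun l _ hl => h1 l (by simpa using hl)
  have h4 : ∀ M, n ≤ M → ∑ l ∈ Finset.range (n + 1), f l =
      ∑ l ∈ Finset.range (M + 1), f l := fun M hM =>
    Finset.sum_subset (Finset.range_mono (by omega)) fun l _ hl => h2 l (by simpa using hl)
  have h5 : ∑ l ∈ Finset.range (d + 1), f l = ∑ l ∈ Finset.range (n + 1), f l :=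
    (h3 (max d n) (le_max_left _ _) (le_max_right _ _)).trans (h4 (max d n) (le_max_right _ _)).symm
  refine h5.trans (Finset.sum_congr rfl fun l hl => ?_)
  have hl' : l ≤ n := Nat.lt_succ_iff.1 (Finset.mem_range.1 hl)
  simp only [hf]
  rw [Nat.sub_add_comm hl']
  refine Finset.sum_congr rfl fun k _ => ?_
  ring

theorem one_add_sigmaOfRadial (ρ : ℂ) : (1 + sigmaOfRadial ρ) / 2 = 4 * ρ / (1 + ρ) ^ 2 := by
  rw [sigmaOfRadial]
  ring

/-- The radial expansion of the free propagator. -/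
theorem hasSum_freePropagator {d : ℕ} (hd : 1 ≤ d) (lam : ℂ) {ρ : ℂ} (h : ‖ρ‖ < 1) :
    HasSum (fun n => BCoeff d n lam * ρ ^ n) (freePropagator d lam (sigmaOfRadial ρ)) := by
  have hab : ((d : ℂ) / 2 + Complex.I * lam) + ((d : ℂ) / 2 - Complex.I * lam) = d := by ring
  rw [freePropagator, one_add_sigmaOfRadial, hypergeometricF_eq hd hab (four_mul_mem_cutPlane h),
    radialOf_four_mul h]
  have hs := hasSum_evalAt (absConvAt_bSeries hd ((d : ℂ) / 2 + Complex.I * lam)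
    ((d : ℂ) / 2 - Complex.I * lam) h)
  have hs' := hs.mul_left (Complex.Gamma ((d : ℂ) / 2 + Complex.I * lam) *
    Complex.Gamma ((d : ℂ) / 2 - Complex.I * lam) /
      ((((4 * Real.pi) ^ (((d : ℝ) + 1) / 2) : ℝ) : ℂ) * Complex.Gamma (((d : ℂ) + 1) / 2)))
  rw [div_mul_div_comm, ← div_mul_eq_mul_div]
  have hfun : (fun n => BCoeff d n lam * ρ ^ n) = fun n => _ := funext fun n => by
    rw [BCoeff, bCoeff_eq, mul_assoc]
  rw [hfun]
  exact hs'

end DeSitter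

namespace DeSitter

open PowerSeries Filter Topology
open scoped ComplexOrder

/-! ### Positivity and continuity of `Bₙ` -/

theorem prefactor_nonneg (d : ℕ) :
    (0 : ℂ) ≤ (((4 * Real.pi) ^ (((d : ℝ) + 1) / 2) : ℝ) : ℂ) *
      Complex.Gamma (((d : ℂ) + 1) / 2) := by
  have h1 : (((d : ℂ) + 1) / 2) = ((((d : ℝ) + 1) / 2 : ℝ) : ℂ) := by push_cast; ring
  rw [h1, Complex.Gamma_ofReal, ← Complex.ofReal_mul]
  refine Complex.zero_le_real.2 (mul_nonneg ?_ (Real.Gamma_pos_of_pos (by positivity)).le)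
  have := Real.pi_pos
  positivity

theorem BCoeff_nonneg_of_bSeries {d n : ℕ} {lam : ℂ}
    (hΓ : 0 ≤ Complex.Gamma ((d : ℂ) / 2 + Complex.I * lam) *
      Complex.Gamma ((d : ℂ) / 2 - Complex.I * lam))
    (hb : NonnegCoeffs (bSeries d ((d : ℂ) / 2 + Complex.I * lam)
      ((d : ℂ) / 2 - Complex.I * lam))) : 0 ≤ BCoeff d n lam := by
  rw [BCoeff, bCoeff_eq]
  exact mul_nonneg (div_nonneg hΓ (prefactor_nonneg d)) (hb n)

theorem BCoeff_nonneg_principal {d : ℕ} (hd : 1 ≤ d) (n : ℕ) (lam : ℝ) :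
    0 ≤ BCoeff d n (lam : ℂ) := by
  have hstar : (d : ℂ) / 2 - Complex.I * lam = star ((d : ℂ) / 2 + Complex.I * lam) := by
    simp [sub_eq_add_neg]
  refine BCoeff_nonneg_of_bSeries ?_ (nonnegCoeffs_bSeries_of_star hd hstar)
  have : Complex.Gamma (star ((d : ℂ) / 2 + Complex.I * lam)) =
      star (Complex.Gamma ((d : ℂ) / 2 + Complex.I * lam)) := Complex.Gamma_conj _
  rw [hstar, this]
  exact mul_star_self_nonneg _

theorem BCoeff_nonneg_complementary {d : ℕ} (hd : 1 ≤ d) (n : ℕ) {lam : ℝ}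
    (hlam : lam ∈ complementaryRange d) : 0 ≤ BCoeff d n (Complex.I * lam) := by
  have h1 : (d : ℂ) / 2 + Complex.I * (Complex.I * lam) = (((d : ℝ) / 2 - lam : ℝ) : ℂ) := by
    rw [← mul_assoc, Complex.I_mul_I]; push_cast; ring
  have h2 : (d : ℂ) / 2 - Complex.I * (Complex.I * lam) = (((d : ℝ) / 2 + lam : ℝ) : ℂ) := by
    rw [← mul_assoc, Complex.I_mul_I]; push_cast; ring
  obtain ⟨hl, hr⟩ := hlam
  refine BCoeff_nonneg_of_bSeries ?_ ?_
  · rw [h1, h2, Complex.Gamma_ofReal, Complex.Gamma_ofReal, ← Complex.ofReal_mul]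
    exact Complex.zero_le_real.2 (mul_nonneg (Real.Gamma_pos_of_pos (by linarith)).le
      (Real.Gamma_pos_of_pos (by linarith)).le)
  · rw [bSeries_eq_fSeries (by ring), h1, h2]
    rcases le_total 0 lam with h | h
    · rw [fSeries_comm]
      exact nonnegCoeffs_fSeries d hd lam h hr
    · have := nonnegCoeffs_fSeries d hd (-lam) (by linarith) (by linarith)
      rwa [← sub_eq_add_neg, sub_neg_eq_add] at this

theorem continuous_poch (n : ℕ) : Continuous fun x : ℂ => poch x n :=
  (ascPochhammer ℂ n).continuous

theorem continuous_aCoeff (n : ℕ) (h : ℂ) : Continuous fun δ : ℂ => aCoeff n h δ := by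
  unfold aCoeff
  refine continuous_finsetSum _ fun k _ => Continuous.div_const ?_ _
  exact (continuous_const.mul ((continuous_poch k).comp (by fun_prop))).mul
    ((continuous_poch (n - k)).comp (by fun_prop))

theorem continuous_bCoeff (d n : ℕ) : Continuous fun lam : ℂ => bCoeff d n lam := by
  unfold bCoeff
  refine continuous_finsetSum _ fun l _ => continuous_finsetSum _ fun k _ => ?_
  exact continuous_const.mul (((continuous_aCoeff _ _).comp (by fun_prop)).mul
    ((continuous_aCoeff _ _).comp (by fun_prop)))

theorem continuousAt_Gamma_of_re_pos {s : ℂ} (hs : 0 < s.re) : ContinuousAt Complex.Gamma s := by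
  refine (Complex.differentiableAt_Gamma s fun m h => ?_).continuousAt
  rw [h] at hs
  simp at hs
  have : (0 : ℝ) ≤ m := Nat.cast_nonneg m
  linarith

theorem continuousAt_BCoeff (d n : ℕ) {lam : ℂ} (h1 : -((d : ℝ) / 2) < lam.im)
    (h2 : lam.im < (d : ℝ) / 2) : ContinuousAt (BCoeff d n) lam := by
  have e : ((d : ℂ) / 2).re = (d : ℝ) / 2 := by simp
  have g1 : ContinuousAt (fun lam : ℂ => Complex.Gamma ((d : ℂ) / 2 + Complex.I * lam)) lam := by
    refine ContinuousAt.comp (f := fun lam : ℂ => (d : ℂ) / 2 + Complex.I * lam)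
      (continuousAt_Gamma_of_re_pos ?_) (by fun_prop)
    rw [Complex.add_re, e, Complex.I_mul_re]
    linarith
  have g2 : ContinuousAt (fun lam : ℂ => Complex.Gamma ((d : ℂ) / 2 - Complex.I * lam)) lam := by
    refine ContinuousAt.comp (f := fun lam : ℂ => (d : ℂ) / 2 - Complex.I * lam)
      (continuousAt_Gamma_of_re_pos ?_) (by fun_prop)
    rw [Complex.sub_re, e, Complex.I_mul_re]
    linarith
  exact ((g1.mul g2).div_const _).mul (continuous_bCoeff d n).continuousAt

/-! ### Integration of series with nonnegative coefficients -/

theorem hasSum_norm_of_nonneg {b : ℕ → ℂ} (hb : ∀ n, 0 ≤ b n) {r : ℝ} {s : ℂ}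
    (hs : HasSum (fun n => b n * (r : ℂ) ^ n) s) : HasSum (fun n => ‖b n‖ * r ^ n) s.re := by
  have h := Complex.hasSum_re hs
  refine h.congr_fun fun n => ?_
  conv_rhs => rw [Complex.eq_coe_norm_of_nonneg (hb n)]
  rw [← Complex.ofReal_pow, ← Complex.ofReal_mul, Complex.ofReal_re]

/-- Nonnegativity makes `P r`, for real `r`, the sum of the norms of the terms at every `ρ` with
`|ρ| = r`. Its integrability therefore controls each coefficient, the sum of the integrated norms,
and `P ρ` itself. -/
theorem integrate_series {μ : Measure ℝ} {B : ℕ → ℝ → ℂ} {P : ℂ → ℝ → ℂ}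
    (hmeas : ∀ n, AEStronglyMeasurable (B n) μ) (hnonneg : ∀ᵐ x ∂μ, ∀ n, 0 ≤ B n x)
    (hsum : ∀ x, ∀ ρ : ℂ, ‖ρ‖ < 1 → HasSum (fun n => B n x * ρ ^ n) (P ρ x))
    (hint : ∀ r : ℝ, 0 ≤ r → r < 1 → Integrable (P r) μ) :
    (∀ n, Integrable (B n) μ ∧ ∫ x, B n x ∂μ = ((∫ x, ‖B n x‖ ∂μ : ℝ) : ℂ)) ∧
      ∀ ρ : ℂ, ‖ρ‖ < 1 → Integrable (P ρ) μ ∧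
        HasSum (fun n => (∫ x, B n x ∂μ) * ρ ^ n) (∫ x, P ρ x ∂μ) := by
  have hB : ∀ᵐ x ∂μ, ∀ r : ℝ, 0 ≤ r → r < 1 →
      HasSum (fun n => ‖B n x‖ * r ^ n) (P r x).re := by
    filter_upwards [hnonneg] with x hx r h0 h1
    exact hasSum_norm_of_nonneg hx (hsum x r (by
      rwa [Complex.norm_real, Real.norm_of_nonneg h0]))
  have hBint : ∀ n, Integrable (B n) μ := by
    intro n
    -- Any fixed positive radius would do: one term of a nonnegative series is at most its sum.
    have h := ((hint (1 / 2) (by norm_num) (by norm_num)).norm.const_mul ((2 : ℝ) ^ n))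
    refine h.mono (hmeas n) ?_
    filter_upwards [hB] with x hx
    have hx' := hx (1 / 2) (by norm_num) (by norm_num)
    have h1 := le_hasSum hx' n fun m _ => by positivity
    have h2 := h1.trans (Complex.re_le_norm _)
    rw [Real.norm_of_nonneg (by positivity)]
    calc ‖B n x‖ = 2 ^ n * (‖B n x‖ * (1 / 2) ^ n) := by
          rw [mul_comm, mul_assoc, ← mul_pow]; norm_num
      _ ≤ _ := mul_le_mul_of_nonneg_left h2 (by positivity)
  refine ⟨fun n => ⟨hBint n, ?_⟩, fun ρ hρ => ?_⟩
  · rw [← integral_complex_ofReal]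
    refine integral_congr_ae ?_
    filter_upwards [hnonneg] with x hx
    exact Complex.eq_coe_norm_of_nonneg (hx n)
  · have hr0 := norm_nonneg ρ
    have hterm : ∀ n, Integrable (fun x => B n x * ρ ^ n) μ := fun n => (hBint n).mul_const _
    -- The finite sums of norms lie below `‖P ‖ρ‖‖` pointwise, so their integrals have a bound
    -- independent of `N`.
    have hle : Summable fun n => ∫ x, ‖B n x * ρ ^ n‖ ∂μ := by
      refine summable_of_sum_range_le (c := ∫ x, ‖P ‖ρ‖ x‖ ∂μ)
        (fun n => integral_nonneg fun _ => norm_nonneg _) fun N => ?_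
      rw [← integral_finsetSum _ fun n _ => (hterm n).norm]
      refine integral_mono_ae (integrable_finsetSum _ fun n _ => (hterm n).norm)
        (hint ‖ρ‖ hr0 hρ).norm ?_
      filter_upwards [hB] with x hx
      refine le_trans ?_ (Complex.re_le_norm _)
      refine le_trans (le_of_eq ?_) (sum_le_hasSum (Finset.range N) (fun m _ => by positivity)
        (hx ‖ρ‖ hr0 hρ))
      simp only [norm_mul, norm_pow]
    have hmain := hasSum_integral_of_summable_integral_norm hterm hle
    have htsum : ∀ x, ∑' n, B n x * ρ ^ n = P ρ x := fun x => (hsum x ρ hρ).tsum_eq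
    simp only [htsum, integral_mul_const] at hmain
    refine ⟨?_, hmain⟩
    refine (hint ‖ρ‖ hr0 hρ).mono ?_ ?_
    · refine aestronglyMeasurable_of_tendsto_ae atTop
        (f := fun N x => ∑ n ∈ Finset.range N, B n x * ρ ^ n) (fun N => ?_)
        (Eventually.of_forall fun x => (hsum x ρ hρ).tendsto_sum_nat)
      exact (integrable_finsetSum _ fun n _ => hterm n).aestronglyMeasurable
    · filter_upwards [hB] with x hx
      have hx' := hx ‖ρ‖ hr0 hρ
      refine le_trans ?_ (Complex.re_le_norm _)
      rw [← (hsum x ρ hρ).tsum_eq, ← hx'.tsum_eq]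
      refine (norm_tsum_le_tsum_norm ?_).trans (le_of_eq ?_)
      · simpa only [norm_mul, norm_pow] using hx'.summable
      · simp only [norm_mul, norm_pow]

/-! ### Points of the sphere -/

theorem exists_sphere_points (d : ℕ) {s : ℝ} (h1 : -1 ≤ s) (h2 : s < 1) :
    ∃ Y₁ Y₂ : Sphere d, Y₁ ≠ Y₂ ∧ sphereSigma Y₁ Y₂ = s := by
  have hsq : 0 ≤ 1 - s ^ 2 := by nlinarith
  set e : Fin (d + 2) → EuclideanSpace ℝ (Fin (d + 2)) := fun i => EuclideanSpace.single i 1 with he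
  have i00 : inner ℝ (e 0) (e 0) = 1 := by simp [he]
  have i11 : inner ℝ (e 1) (e 1) = 1 := by simp [he]
  have i01 : inner ℝ (e 0) (e 1) = 0 := by
    rw [he, EuclideanSpace.inner_single_left]
    simp
  set y := s • e 0 + Real.sqrt (1 - s ^ 2) • e 1 with hy
  have hin : inner ℝ (e 0) y = s := by
    rw [hy, inner_add_right, inner_smul_right, inner_smul_right, i00, i01]
    ring
  have hyy : inner ℝ y y = 1 := by
    have hss := Real.mul_self_sqrt hsq
    rw [hy]
    simp only [inner_add_right, inner_add_left, inner_smul_right, inner_smul_left, i00, i01, i11,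
      real_inner_comm (e 0) (e 1), conj_trivial]
    nlinarith
  have n0 : ‖e 0‖ = 1 := by simp [he]
  have ny : ‖y‖ = 1 := by
    rw [real_inner_self_eq_norm_sq] at hyy
    nlinarith [norm_nonneg y]
  refine ⟨⟨e 0, by simpa using n0⟩, ⟨y, by simpa using ny⟩, ?_, hin⟩
  intro h
  have h' : e 0 = y := congrArg Subtype.val h
  rw [← h', i00] at hin
  linarith

theorem sphereSigma_lt_one {d : ℕ} {Y₁ Y₂ : Sphere d} (h : Y₁ ≠ Y₂) : sphereSigma Y₁ Y₂ < 1 := by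
  have n1 : ‖(Y₁ : EuclideanSpace ℝ (Fin (d + 2)))‖ = 1 := by simp
  have n2 : ‖(Y₂ : EuclideanSpace ℝ (Fin (d + 2)))‖ = 1 := by simp
  exact (inner_lt_one_iff_real_of_norm_eq_one n1 n2).2 fun h' => h (Subtype.ext h')

theorem half_one_add_mem_cutPlane {s : ℝ} (hs : s < 1) : (1 + (s : ℂ)) / 2 ∈ cutPlane := by
  rw [cutPlane, Set.mem_ofPred_eq, Complex.mem_slitPlane_iff]
  left
  have : (1 - (1 + (s : ℂ)) / 2) = (((1 - s) / 2 : ℝ) : ℂ) := by push_cast; ring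
  rw [this, Complex.ofReal_re]
  linarith

theorem sigmaOfRadial_radial {s : ℝ} (hs : s < 1) : sigmaOfRadial (radial s) = s := by
  have h := four_mul_radialOf (half_one_add_mem_cutPlane hs)
  rw [← radial_eq_radialOf, ← one_add_sigmaOfRadial] at h
  linear_combination 2 * h

/-- The only place where convergence is drawn from the sphere: `σ = 8r/(1+r)² - 1` lies in `[-1, 1)`
and is thus the inner product of two distinct points. -/
theorem spectralConverges_of_real {d : ℕ} {μP μC : Measure ℝ} {G : Sphere d → Sphere d → ℂ}
    (hG : HasKallenLehmann d μP μC G) {r : ℝ} (h0 : 0 ≤ r) (h1 : r < 1) :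
    SpectralConverges d μP μC (fun lam => freePropagator d lam (sigmaOfRadial r)) := by
  have hpos : 0 < (1 + r) ^ 2 := by positivity
  obtain ⟨Y₁, Y₂, hne, hs⟩ := exists_sphere_points d (s := 8 * r / (1 + r) ^ 2 - 1)
    (by have : 0 ≤ 8 * r / (1 + r) ^ 2 := by positivity
        linarith)
    (by have : 8 * r / (1 + r) ^ 2 < 2 := by
          rw [div_lt_iff₀ hpos]
          nlinarith [mul_pos (sub_pos.2 h1) (sub_pos.2 h1)]
        linarith)
  have h := (hG Y₁ Y₂ hne).1
  rw [hs] at h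
  have e : ((8 * r / (1 + r) ^ 2 - 1 : ℝ) : ℂ) = sigmaOfRadial r := by
    rw [sigmaOfRadial]; push_cast; ring
  rwa [e] at h

end DeSitter

/-! ### Integration over the spectrum -/

theorem corollary1 (d : ℕ) (hd : 1 ≤ d) (μP μC : MeasureTheory.Measure ℝ)
    (G : DeSitter.Sphere d → DeSitter.Sphere d → ℂ)
    (hG : DeSitter.HasKallenLehmann d μP μC G) :
    ∃ c : ℕ → ℝ,
      (∀ n, 0 ≤ c n) ∧
      -- the coefficients are convergent spectral integrals of `Bₙ(d, λ)`
      (∀ n, DeSitter.SpectralConverges d μP μC (DeSitter.BCoeff d n) ∧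
        (c n : ℂ) = DeSitter.spectralIntegral d μP μC (DeSitter.BCoeff d n)) ∧
      -- the expansion of the two-point function on the sphere
      (∀ Y₁ Y₂ : DeSitter.Sphere d, Y₁ ≠ Y₂ →
        ‖DeSitter.radial (DeSitter.sphereSigma Y₁ Y₂ : ℂ)‖ < 1 ∧
        HasSum (fun n => (c n : ℂ) * DeSitter.radial (DeSitter.sphereSigma Y₁ Y₂ : ℂ) ^ n)
          (G Y₁ Y₂)) ∧
      -- on the whole open unit disc the series converges absolutely, the Källén–Lehmann
      -- representation converges, and they agree
      (∀ ρ : ℂ, ‖ρ‖ < 1 →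
        DeSitter.SpectralConverges d μP μC
          (fun lam => DeSitter.freePropagator d lam (DeSitter.sigmaOfRadial ρ)) ∧
        HasSum (fun n => (c n : ℂ) * ρ ^ n)
          (DeSitter.spectralIntegral d μP μC
            (fun lam => DeSitter.freePropagator d lam (DeSitter.sigmaOfRadial ρ)))) := by
  open DeSitter in
  have hd0 : (0 : ℝ) < (d : ℝ) / 2 := by
    have : (1 : ℝ) ≤ d := by exact_mod_cast hd
    linarith
  have hms : MeasurableSet (complementaryRange d) := measurableSet_Ioo
  obtain ⟨hP1, hP2⟩ := integrate_series (μ := μP) (B := fun n lam => BCoeff d n (lam : ℂ))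
    (P := fun ρ lam => freePropagator d (lam : ℂ) (sigmaOfRadial ρ))
    (fun n => (Continuous.aestronglyMeasurable (continuous_iff_continuousAt.2 fun x =>
      ContinuousAt.comp (f := fun x : ℝ => (x : ℂ)) (g := BCoeff d n)
        (continuousAt_BCoeff d n (by simpa using hd0) (by simpa using hd0))
        Complex.continuous_ofReal.continuousAt)))
    (Filter.Eventually.of_forall fun x n => BCoeff_nonneg_principal hd n x)
    (fun x ρ hρ => hasSum_freePropagator hd x hρ)
    (fun r h0 h1 => (spectralConverges_of_real hG h0 h1).1)
  -- Continuity and sign of `Bₙ` are available only for `λ` in the open interval, where both Gamma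
  -- arguments are positive; hence the restricted measure and the almost-everywhere hypothesis.
  obtain ⟨hC1, hC2⟩ := integrate_series (μ := μC.restrict (complementaryRange d))
    (B := fun n lam => BCoeff d n (Complex.I * (lam : ℂ)))
    (P := fun ρ lam => freePropagator d (Complex.I * (lam : ℂ)) (sigmaOfRadial ρ))
    (fun n => (ContinuousOn.aestronglyMeasurable (fun x hx => ContinuousAt.continuousWithinAt
      (ContinuousAt.comp (f := fun x : ℝ => Complex.I * (x : ℂ)) (g := BCoeff d n)
        (continuousAt_BCoeff d n (by simpa using hx.1) (by simpa using hx.2))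
        (by fun_prop))) hms))
    ((MeasureTheory.ae_restrict_mem hms).mono fun x hx n => BCoeff_nonneg_complementary hd n hx)
    (fun x ρ hρ => hasSum_freePropagator hd _ hρ)
    (fun r h0 h1 => (spectralConverges_of_real hG h0 h1).2)
  -- Integrating norms makes `c n` real and nonnegative by construction; it equals the spectral
  -- integral because `Bₙ` is its own norm on the spectrum.
  set c : ℕ → ℝ := fun n => (∫ lam, ‖BCoeff d n (lam : ℂ)‖ ∂μP) +
    ∫ lam in complementaryRange d, ‖BCoeff d n (Complex.I * (lam : ℂ))‖ ∂μC with hc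
  have hcn : ∀ n, (c n : ℂ) = spectralIntegral d μP μC (BCoeff d n) := by
    intro n
    rw [spectralIntegral, (hP1 n).2, (hC1 n).2, hc]
    push_cast
    rfl
  have hdisc : ∀ ρ : ℂ, ‖ρ‖ < 1 →
      SpectralConverges d μP μC (fun lam => freePropagator d lam (sigmaOfRadial ρ)) ∧
      HasSum (fun n => (c n : ℂ) * ρ ^ n)
        (spectralIntegral d μP μC (fun lam => freePropagator d lam (sigmaOfRadial ρ))) := by
    intro ρ hρ
    obtain ⟨p1, p2⟩ := hP2 ρ hρ
    obtain ⟨q1, q2⟩ := hC2 ρ hρ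
    refine ⟨⟨p1, q1⟩, ?_⟩
    have h := p2.add q2
    simp only [hcn, spectralIntegral, add_mul]
    exact h
  refine ⟨c, fun n => add_nonneg (MeasureTheory.integral_nonneg fun _ => norm_nonneg _)
    (MeasureTheory.integral_nonneg fun _ => norm_nonneg _),
    fun n => ⟨⟨(hP1 n).1, (hC1 n).1⟩, hcn n⟩, fun Y₁ Y₂ hne => ?_, hdisc⟩
  have hlt := sphereSigma_lt_one hne
  have hρ : ‖radial (sphereSigma Y₁ Y₂ : ℂ)‖ < 1 :=
    norm_radialOf_lt_one (half_one_add_mem_cutPlane hlt)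
  refine ⟨hρ, ?_⟩
  have h := (hdisc _ hρ).2
  rw [sigmaOfRadial_radial hlt] at h
  rwa [(hG Y₁ Y₂ hne).2]
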